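/- For $\boldsymbol\alpha\in\mathbb{R}^d$ and $\eta\in\mathbb{R}$ let $\mathcal{A}_\eta(\boldsymbol\alpha)$ denote the set of all accumulation points in $\mathbb{R}^d$ of the set $\{|q|^{\eta}(q\boldsymbol\alpha-\boldsymbol p): q\in\mathbb{Z}\setminus\{0\},\ \boldsymbol p\in\mathbb{Z}^d\}$. Let $K\subset\mathbb{R}$ be a cubic number field, let $\boldsymbol\alpha=(\alpha_1,\alpha_2)\in K^2\subset\mathbb{R}^2$ be such that $\{1,\alpha_1,\alpha_2\}$ is a basis of $K$ over $\mathbb{Q}$, let $\mathrm{N}$ and $\mathrm{Tr}$ denote the norm and the trace of $K/\mathbb{Q}$, put $\Lambda=\mathbb{Z}+\alpha_1\mathbb{Z}+\alpha_2\mathbb{Z}$, and let $\Lambda^*=\{s\in K:\mathrm{Tr}(s\beta)\in\mathbb{Z}\text{ for all }\beta\in\Lambda\}$ be the lattice dual to $\Lambda$ with respect to the trace form. (1) If $K$ has a field embedding into $\mathbb{C}$ whose image is not contained in $\mathbb{R}$, then there is an ellipse $\mathcal{C}_K\subset\mathbb{R}^2$ (possibly a circle) such that $$\mathcal{A}_{1/2}(\boldsymbol\alpha)=\bigcup_{s\in\Lambda^*\setminus\{0\}}|\mathrm{N}(s)|^{1/2}\,\mathcal{C}_K.$$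 (2) If $K$ is totally real, then there are a hyperbola $\mathcal{C}_K^+\subset\mathbb{R}^2$ and, for every $s\in\Lambda^*\setminus\{0\}$, a linear map $\ell_s:\mathbb{R}^2\to\mathbb{R}^2$ which either is the identity or maps $\mathcal{C}_K^+$ onto its conjugate hyperbola, such that $$\mathcal{A}_{1/2}(\boldsymbol\alpha)=\bigcup_{s\in\Lambda^*\setminus\{0\}}|\mathrm{N}(s)|^{1/2}\,\ell_s(\mathcal{C}_K^+).$$ -/

import Mathlib

open scoped Pointwise

noncomputable section

/-- The set `NA_η(α)` of `η`-normalized approximations `|q|^η (q α - p)` to `α ∈ ℝ^d`, where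
`q` runs over the nonzero integers and `p` over `ℤ^d`. -/
def normalizedApproximations {d : ℕ} (η : ℝ) (α : Fin d → ℝ) : Set (Fin d → ℝ) :=
  {x | ∃ (q : ℤ) (p : Fin d → ℤ), q ≠ 0 ∧
    x = |(q : ℝ)| ^ η • ((q : ℝ) • α - fun i => (p i : ℝ))}

/-- The set `A_η(α)` of accumulation points of `NA_η(α)`. -/
def accumulationSet {d : ℕ} (η : ℝ) (α : Fin d → ℝ) : Set (Fin d → ℝ) :=
  derivedSet (normalizedApproximations η α)

/-- An ellipse in the plane: the image of the unit circle under an invertible affine map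
(circles are ellipses). -/
def IsEllipse (C : Set (Fin 2 → ℝ)) : Prop :=
  ∃ f : (Fin 2 → ℝ) ≃ᵃ[ℝ] (Fin 2 → ℝ), C = f '' {x | x 0 ^ 2 + x 1 ^ 2 = 1}

/-- `C` and `D` are conjugate hyperbolas: in a common affine coordinate system they have the
equations `x y = 1` and `x y = -1`. For `C : x² / a² - y² / b² = 1` this says that `D` is
`x² / a² - y² / b² = -1`. -/
def AreConjugateHyperbolas (C D : Set (Fin 2 → ℝ)) : Prop :=
  ∃ f : (Fin 2 → ℝ) ≃ᵃ[ℝ] (Fin 2 → ℝ),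
    C = f '' {x | x 0 * x 1 = 1} ∧ D = f '' {x | x 0 * x 1 = -1}

/-- A hyperbola in the plane (both branches): the image of `x y = 1` under an invertible affine
map. -/
def IsHyperbola (C : Set (Fin 2 → ℝ)) : Prop :=
  ∃ f : (Fin 2 → ℝ) ≃ᵃ[ℝ] (Fin 2 → ℝ), C = f '' {x | x 0 * x 1 = 1}

/-- The lattice in `K` dual to a lattice `L ⊆ K` with respect to the trace form of `K / ℚ`: all
`s ∈ K` with `Tr (s β) ∈ ℤ` for every `β ∈ L`. -/
def traceDual (K : Type*) [Field K] [Algebra ℚ K] (L : Submodule ℤ K) : Submodule ℤ K :=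
  (Algebra.traceForm ℚ K).dualSubmodule L

end

/-! The trace form is nondegenerate, so `s ↦ (Tr s, Tr (s α₀), Tr (s α₁))` identifies the dual
lattice with the triples `(q, p)`. In `q αᵢ - pᵢ = Tr s · αᵢ - Tr (s αᵢ)` the term from the identity
embedding cancels, leaving an invertible linear function of the two other conjugates of `s`. If the
normalized errors stay bounded while `|q| → ∞`, these conjugates tend to zero and `|q| - |s| → 0`. A
quadratic form in them (`|φ s|²`, or `σ s · τ s`), scaled by `|s|`, is `± N(s)`.

Norms from the dual lattice have a common denominator, so along a convergent sequence these values
are eventually constant. Every accumulation point thus lies on a level curve attached to some `s`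
(`exists_form_eq_of_mem_accumulationSet`).

Conversely, multiplying `s` by norm-one units that preserve the lattice moves the scaled conjugates
along the level curve: by rotations in the complex case, by hyperbolic rotations in the real one.
The parameters reached, together with `s ↦ -s` in the real case, are dense, since an element above 1
of norm 1 in a cubic field has distinct conjugates (`exists_near_circle_point`,
`exists_near_hyperbola_point`). Connectedness of the curve then turns closure points into
accumulation points. -/

open NumberField Filter Topology

/-! ### The dual lattice: trace coordinates, denominators, action of units -/

section DualLattice

variable {K : IntermediateField ℚ ℝ} {α : Fin 2 → K}

theorem mem_traceDual_span_iff (s : K) :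
    s ∈ traceDual K (Submodule.span ℤ (Set.range ![(1 : K), α 0, α 1])) ↔
      (∃ q : ℤ, Algebra.trace ℚ K s = q) ∧
        ∀ i, ∃ p : ℤ, Algebra.trace ℚ K (s * α i) = p := by
  have key : s ∈ traceDual K (Submodule.span ℤ (Set.range ![(1 : K), α 0, α 1])) ↔
      ∀ y ∈ Submodule.span ℤ (Set.range ![(1 : K), α 0, α 1]),
        ∃ q : ℤ, Algebra.trace ℚ K (s * y) = q := by
    simp only [traceDual, LinearMap.BilinForm.mem_dualSubmodule, Submodule.mem_one,
      Algebra.traceForm_apply]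
    simp [eq_comm]
  rw [key]
  constructor
  · intro h
    refine ⟨by simpa using h 1 (Submodule.subset_span ⟨0, rfl⟩), fun i => ?_⟩
    fin_cases i
    · exact h (α 0) (Submodule.subset_span ⟨1, rfl⟩)
    · exact h (α 1) (Submodule.subset_span ⟨2, rfl⟩)
  · rintro ⟨h0, h1⟩ y hy
    induction hy using Submodule.span_induction with
    | mem x hx =>
      obtain ⟨j, rfl⟩ := hx
      fin_cases j
      · simpa using h0
      · exact h1 0
      · exact h1 1
    | zero => exact ⟨0, by simp⟩
    | add x y _ _ hx hy =>
      obtain ⟨a, ha⟩ := hx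
      obtain ⟨b, hb⟩ := hy
      exact ⟨a + b, by rw [mul_add, map_add, ha, hb]; push_cast; rfl⟩
    | smul a x _ hx =>
      obtain ⟨b, hb⟩ := hx
      exact ⟨a * b, by rw [mul_smul_comm, map_zsmul, hb]; push_cast; simp⟩

theorem exists_eq_rat_combination (hspan : Submodule.span ℚ (Set.range ![(1 : K), α 0, α 1]) = ⊤)
    (x : K) : ∃ a b c : ℚ, x = algebraMap ℚ K a + b • α 0 + c • α 1 := by
  have hx : x ∈ Submodule.span ℚ (Set.range ![(1 : K), α 0, α 1]) := hspan ▸ Submodule.mem_top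
  obtain ⟨c, rfl⟩ := (Submodule.mem_span_range_iff_exists_fun ℚ).1 hx
  exact ⟨c 0, c 1, c 2, by simp [Fin.sum_univ_three, Algebra.smul_def]⟩

theorem finiteDimensional_of_span
    (hspan : Submodule.span ℚ (Set.range ![(1 : K), α 0, α 1]) = ⊤) :
    FiniteDimensional ℚ K :=
  ⟨⟨(Set.finite_range ![(1 : K), α 0, α 1]).toFinset, by simpa using hspan⟩⟩

theorem finrank_eq_three (hindep : LinearIndependent ℚ ![(1 : K), α 0, α 1])
    (hspan : Submodule.span ℚ (Set.range ![(1 : K), α 0, α 1]) = ⊤) :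
    Module.finrank ℚ K = 3 := by
  simpa using Module.finrank_eq_card_basis (Module.Basis.mk hindep hspan.ge)

/-- By nondegeneracy of the trace form, the functional with these values on the basis is `Tr (s · )`
for some `s`. This turns any pair `(q, p)` into a lattice element. -/
theorem exists_trace_eq [FiniteDimensional ℚ K]
    (hindep : LinearIndependent ℚ ![(1 : K), α 0, α 1])
    (hspan : Submodule.span ℚ (Set.range ![(1 : K), α 0, α 1]) = ⊤) (q : ℚ) (p : Fin 2 → ℚ) :
    ∃ s : K, Algebra.trace ℚ K s = q ∧ ∀ i, Algebra.trace ℚ K (s * α i) = p i := by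
  let b := Module.Basis.mk hindep hspan.ge
  let f : Module.Dual ℚ K := b.constr ℚ ![q, p 0, p 1]
  let s := ((Algebra.traceForm ℚ K).toDual (traceForm_nondegenerate ℚ K)).symm f
  have hs : ∀ y, Algebra.trace ℚ K (s * y) = f y := fun y => by
    rw [← Algebra.traceForm_apply]
    exact LinearMap.BilinForm.apply_toDual_symm_apply ..
  have hb : ∀ j, f (![(1 : K), α 0, α 1] j) = ![q, p 0, p 1] j := fun j => by
    have := b.constr_basis ℚ ![q, p 0, p 1] j
    rwa [Module.Basis.mk_apply] at this
  refine ⟨s, ?_, fun i => ?_⟩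
  · rw [← mul_one s, hs]; exact hb 0
  · rw [hs]
    fin_cases i
    · exact hb 1
    · exact hb 2

theorem exists_int_mul_isIntegral [FiniteDimensional ℚ K] (x : K) :
    ∃ y : ℤ, y ≠ 0 ∧ IsIntegral ℤ ((y : K) * x) := by
  obtain ⟨y, hy, h⟩ := IsAlgebraic.exists_integral_multiple (R := ℤ) (z := x)
    ((IsFractionRing.isAlgebraic_iff ℤ ℚ K).2 (Algebra.IsAlgebraic.isAlgebraic x))
  exact ⟨y, hy, by simpa using h⟩

theorem exists_common_denominator [FiniteDimensional ℚ K]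
    (hindep : LinearIndependent ℚ ![(1 : K), α 0, α 1])
    (hspan : Submodule.span ℚ (Set.range ![(1 : K), α 0, α 1]) = ⊤) :
    ∃ e : ℤ, e ≠ 0 ∧ ∀ s ∈ traceDual K (Submodule.span ℤ (Set.range ![(1 : K), α 0, α 1])),
      IsIntegral ℤ ((e : K) * s) := by
  obtain ⟨u, hu, hu'⟩ := exists_trace_eq hindep hspan 1 0
  obtain ⟨v, hv, hv'⟩ := exists_trace_eq hindep hspan 0 ![1, 0]
  obtain ⟨w, hw, hw'⟩ := exists_trace_eq hindep hspan 0 ![0, 1]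
  obtain ⟨a, ha, ha'⟩ := exists_int_mul_isIntegral u
  obtain ⟨b, hb, hb'⟩ := exists_int_mul_isIntegral v
  obtain ⟨c, hc, hc'⟩ := exists_int_mul_isIntegral w
  refine ⟨a * b * c, by positivity, fun s hs => ?_⟩
  rw [mem_traceDual_span_iff] at hs
  obtain ⟨⟨q, hq⟩, h⟩ := hs
  obtain ⟨p, hp⟩ := h 0
  obtain ⟨r, hr⟩ := h 1
  -- `u, v, w` is the trace-dual basis, so the difference of the two sides is orthogonal to all of
  -- `K`.
  have hs : s = (q : K) * u + p * v + r * w := by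
    rw [← sub_eq_zero]
    refine (traceForm_nondegenerate ℚ K).1 _ fun y => ?_
    obtain ⟨x, y, z, rfl⟩ := exists_eq_rat_combination hspan y
    have e1 : ∀ t : K, Algebra.trace ℚ K (t * (algebraMap ℚ K x + y • α 0 + z • α 1)) =
        x * Algebra.trace ℚ K t + y * Algebra.trace ℚ K (t * α 0)
          + z * Algebra.trace ℚ K (t * α 1) := fun t => by
      rw [mul_add, mul_add, mul_smul_comm, mul_smul_comm, mul_comm t, ← Algebra.smul_def]
      simp
    have e2 : ∀ (n : ℤ) (t : K), Algebra.trace ℚ K ((n : K) * t) = n * Algebra.trace ℚ K t :=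
      fun n t => by rw [← zsmul_eq_mul, map_zsmul, zsmul_eq_mul]
    rw [Algebra.traceForm_apply, e1]
    simp only [sub_mul, add_mul, map_sub, map_add, mul_assoc, e2, hq, hu, hv, hw, hp, hr, hu',
      hv', hw']
    simp
  have : ((a * b * c : ℤ) : K) * s = (q * b * c : ℤ) * (a * u) + (p * a * c : ℤ) * (b * v) +
      (r * a * b : ℤ) * (c * w) := by
    rw [hs]; push_cast; ring
  rw [this]
  exact (((isIntegral_intCast _).mul ha').add ((isIntegral_intCast _).mul hb')).add ((isIntegral_intCast _).mul hc')

theorem exists_norm_denominator [FiniteDimensional ℚ K]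
    (hindep : LinearIndependent ℚ ![(1 : K), α 0, α 1])
    (hspan : Submodule.span ℚ (Set.range ![(1 : K), α 0, α 1]) = ⊤) :
    ∃ D : ℤ, D ≠ 0 ∧ ∀ s ∈ traceDual K (Submodule.span ℤ (Set.range ![(1 : K), α 0, α 1])),
      ∃ n : ℤ, D * Algebra.norm ℚ s = n := by
  obtain ⟨e, he, h⟩ := exists_common_denominator hindep hspan
  refine ⟨e ^ 3, by positivity, fun s hs => ?_⟩
  obtain ⟨n, hn⟩ := IsIntegrallyClosed.isIntegral_iff.1 (Algebra.isIntegral_norm ℚ (h s hs))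
  refine ⟨n, ?_⟩
  have : Algebra.norm ℚ (e : K) = (e : ℚ) ^ 3 := by
    have := Algebra.norm_algebraMap (S := K) (e : ℚ)
    rwa [finrank_eq_three hindep hspan, map_intCast] at this
  rw [map_mul, this] at hn
  push_cast
  exact hn.symm

theorem exists_integral_multiples_mem_traceDual [NumberField K] :
    ∃ d : ℤ, d ≠ 0 ∧ ∀ x : 𝓞 K,
      (d : K) * x ∈ traceDual K (Submodule.span ℤ (Set.range ![(1 : K), α 0, α 1])) := by
  obtain ⟨a, ha, ha'⟩ := exists_int_mul_isIntegral (α 0)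
  obtain ⟨b, hb, hb'⟩ := exists_int_mul_isIntegral (α 1)
  have htr : ∀ x : K, IsIntegral ℤ x → ∃ p : ℤ, Algebra.trace ℚ K x = p := fun x hx => by
    obtain ⟨n, hn⟩ := IsIntegrallyClosed.isIntegral_iff.1 (Algebra.isIntegral_trace (L := ℚ) hx)
    exact ⟨n, hn.symm⟩
  refine ⟨a * b, by positivity, fun x => ?_⟩
  have hx := RingOfIntegers.isIntegral_coe x
  rw [mem_traceDual_span_iff]
  refine ⟨htr _ ((isIntegral_intCast _).mul hx), fun i => htr _ ?_⟩
  fin_cases i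
  · have := ((isIntegral_intCast b).mul hx).mul ha'
    rwa [show ((b : K) * x) * ((a : K) * α 0) = ((a * b : ℤ) : K) * x * α 0 by
      push_cast; ring] at this
  · have := ((isIntegral_intCast a).mul hx).mul hb'
    rwa [show ((a : K) * x) * ((b : K) * α 1) = ((a * b : ℤ) : K) * x * α 1 by
      push_cast; ring] at this

/-- Some positive power of a unit of `𝓞 K` acts on the dual lattice by automorphisms. -/
theorem exists_unit_pow_smul_mem [NumberField K]
    (hindep : LinearIndependent ℚ ![(1 : K), α 0, α 1])
    (hspan : Submodule.span ℚ (Set.range ![(1 : K), α 0, α 1]) = ⊤) (u : (𝓞 K)ˣ) :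
    ∃ k : ℕ, k ≠ 0 ∧
      ∀ s ∈ traceDual K (Submodule.span ℤ (Set.range ![(1 : K), α 0, α 1])),
        ((u ^ k : (𝓞 K)ˣ) : K) * s ∈
            traceDual K (Submodule.span ℤ (Set.range ![(1 : K), α 0, α 1])) ∧
        (((u ^ k)⁻¹ : (𝓞 K)ˣ) : K) * s ∈
            traceDual K (Submodule.span ℤ (Set.range ![(1 : K), α 0, α 1])) := by
  obtain ⟨e, he, hΛ⟩ := exists_common_denominator hindep hspan
  obtain ⟨d, hd, hO⟩ := exists_integral_multiples_mem_traceDual (K := K) (α := α)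
  set I : Ideal (𝓞 K) := Ideal.span {((d * e : ℤ) : 𝓞 K)} with hI
  have hne : I ≠ ⊥ := by
    rw [hI, Ne, Ideal.span_singleton_eq_bot]
    exact_mod_cast mul_ne_zero hd he
  have : Finite (𝓞 K ⧸ I) := Ideal.finiteQuotientOfFreeOfNeBot I hne
  let f : (𝓞 K)ˣ →* (𝓞 K ⧸ I)ˣ := Units.map (Ideal.Quotient.mk I).toMonoidHom
  -- If `v = 1 + d e y`, then `v s = s + d (y · e s)`, where `e s` is integral and `d 𝓞 K` lies in
  -- the dual lattice. The order of `u` modulo `d e` is therefore a suitable exponent.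
  have key : ∀ v : (𝓞 K)ˣ, f v = 1 →
      ∀ s ∈ traceDual K (Submodule.span ℤ (Set.range ![(1 : K), α 0, α 1])), (v : K) * s ∈
        traceDual K (Submodule.span ℤ (Set.range ![(1 : K), α 0, α 1])) := by
    intro v hv s hs
    have h1 : Ideal.Quotient.mk I (v : 𝓞 K) = Ideal.Quotient.mk I 1 := by
      simpa [f] using congrArg Units.val hv
    rw [Ideal.Quotient.eq, hI, Ideal.mem_span_singleton] at h1
    obtain ⟨y, hy⟩ := h1
    let z : 𝓞 K := ⟨(e : K) * s, hΛ s hs⟩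
    have hy' : (v : K) - 1 = ((d * e : ℤ) : K) * (y : K) := by
      have := congrArg (algebraMap (𝓞 K) K) hy
      simpa using this
    have h2 : (v : K) * s = s + (d : K) * ((y * z : 𝓞 K) : K) := by
      have hz : (z : K) = (e : K) * s := rfl
      have hyz : ((y * z : 𝓞 K) : K) = (y : K) * z := map_mul (algebraMap (𝓞 K) K) y z
      rw [hyz, hz]
      have : (v : K) = 1 + ((d * e : ℤ) : K) * (y : K) := by rw [← hy']; ring
      rw [this]; push_cast; ring
    rw [h2]
    exact add_mem hs (hO _)
  have hk : f (u ^ orderOf (f u)) = 1 := by rw [map_pow, pow_orderOf_eq_one]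
  exact ⟨orderOf (f u), (orderOf_pos _).ne', fun s hs =>
    ⟨key _ hk s hs, key _ (by rw [map_inv, hk, inv_one]) s hs⟩⟩

end DualLattice

/-! ### Kronecker density on the line -/

section Density

theorem exists_nat_mul_add_int_mul_near {a p : ℝ} (h : Irrational (a / p)) (hp : 0 < p)
    (t : ℝ) {τ : ℝ} (hτ : 0 < τ) (M : ℕ) :
    ∃ m : ℕ, M ≤ m ∧ ∃ n : ℤ, |m * a + n * p - t| < τ := by
  have : Fact (0 < p) := ⟨hp⟩
  have hd : DenseRange ((· • (a : AddCircle p)) : ℤ → AddCircle p) :=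
    AddCircle.denseRange_zsmul_coe_iff.2 h
  rw [denseRange_zsmul_iff_nsmul] at hd
  -- Shifting the target by `M * a` makes the exponent `M + k` at least `M`.
  obtain ⟨k, hk⟩ := hd.exists_dist_lt ((t - M * a : ℝ) : AddCircle p) hτ
  refine ⟨M + k, Nat.le_add_right _ _, ?_⟩
  have e : ((t - M * a : ℝ) : AddCircle p) - k • (a : AddCircle p) =
      ((t - M * a - k * a : ℝ) : AddCircle p) := by
    simp
  rw [dist_eq_norm, e, AddCircle.norm_eq] at hk
  refine ⟨round (p⁻¹ * (t - M * a - k * a)), ?_⟩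
  rw [abs_sub_comm]
  convert hk using 2
  push_cast; ring

/-- Because `a` and `c` have opposite signs, a large `m` forces the integer coefficient of `c` to be
positive, so both coefficients are natural numbers. -/
theorem exists_nat_mul_add_nat_mul_near {a c : ℝ} (h : Irrational (a / c)) (hac : a * c < 0)
    (t : ℝ) {τ : ℝ} (hτ : 0 < τ) (M : ℕ) :
    ∃ m n : ℕ, M ≤ m ∧ |m * a + n * c - t| < τ := by
  wlog hc : 0 < c generalizing a c t
  · have hc0 : c ≠ 0 := by rintro rfl; simp at hac
    have hc' : 0 < -c := by have := lt_of_le_of_ne (not_lt.1 hc) hc0; linarith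
    obtain ⟨m, n, hm, hn⟩ := this (a := -a) (c := -c) (by rwa [neg_div_neg_eq]) (by linarith) (-t)
      hc'
    refine ⟨m, n, hm, ?_⟩
    rw [← abs_neg]
    convert hn using 2
    ring
  have ha : a < 0 := by nlinarith
  obtain ⟨N, hN⟩ := exists_nat_gt ((|t| + τ) / -a)
  obtain ⟨m, hm, n, hn⟩ := exists_nat_mul_add_int_mul_near h hc t hτ (max M N)
  have hmN : (N : ℝ) ≤ m := by exact_mod_cast (le_max_right _ _).trans hm
  have h1 : |t| + τ < m * -a := (div_lt_iff₀ (by linarith)).1 (hN.trans_le hmN)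
  have h2 := (abs_lt.1 hn).1
  have h3 : 0 < (n : ℝ) * c := by linarith [neg_abs_le t]
  have h4 : 0 < (n : ℝ) := pos_of_mul_pos_left h3 hc.le
  have h5 : (0 : ℤ) < n := by exact_mod_cast h4
  obtain ⟨n, rfl⟩ := Int.eq_ofNat_of_zero_le h5.le
  exact ⟨m, n, (le_max_left _ _).trans hm, by simpa using hn⟩

end Density

/-! ### Embeddings of a cubic field and Dirichlet units -/

section Embeddings

variable {K : IntermediateField ℚ ℝ} {α : Fin 2 → K}

/-- Prime degree leaves no proper intermediate field, so the equalizer of two distinct embeddings is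
`ℚ`. -/
theorem exists_rat_of_embeddings_eq (hprime : (Module.finrank ℚ K).Prime) {L : Type*} [Field L]
    [Algebra ℚ L] {φ ψ : K →+* L} (hne : φ ≠ ψ) {x : K} (hx : φ x = ψ x) :
    ∃ r : ℚ, algebraMap ℚ K r = x := by
  have := Subalgebra.isSimpleOrder_of_finrank_prime ℚ K hprime
  rcases eq_bot_or_eq_top (AlgHom.equalizer φ.toRatAlgHom ψ.toRatAlgHom) with h | h
  · have hx' : x ∈ AlgHom.equalizer φ.toRatAlgHom ψ.toRatAlgHom := hx
    rw [h] at hx'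
    exact Algebra.mem_bot.1 hx'
  · refine absurd (RingHom.ext fun y => ?_) hne
    have hy : y ∈ AlgHom.equalizer φ.toRatAlgHom ψ.toRatAlgHom := h ▸ Algebra.mem_top
    exact hy

/-- In a cubic real field, elements larger than one of norm one have pairwise distinct
conjugates. -/
theorem embeddings_ne_of_one_lt_of_norm_eq_one (h3 : Module.finrank ℚ K = 3) {L : Type*}
    [Field L] [Algebra ℚ L] {φ ψ : K →+* L} (hne : φ ≠ ψ) {x : K} (hx : (1 : ℝ) < x)
    (hN : Algebra.norm ℚ x = 1) : φ x ≠ ψ x := by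
  intro h
  obtain ⟨r, rfl⟩ := exists_rat_of_embeddings_eq (h3 ▸ Nat.prime_three) hne h
  rw [Algebra.norm_algebraMap, h3] at hN
  have hr : 1 < r := by
    have : (1 : ℝ) < (r : ℝ) := by simpa using hx
    exact_mod_cast this
  exact absurd hN (one_lt_pow₀ hr (by norm_num)).ne'

theorem norm_trace_of_three_embeddings [NumberField K] (h3 : Module.finrank ℚ K = 3)
    {φ ψ : K →+* ℂ} (h1 : algebraMap K ℂ ≠ φ) (h2 : algebraMap K ℂ ≠ ψ) (h12 : φ ≠ ψ) (s : K) :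
    (Algebra.trace ℚ K s : ℂ) = (s : ℝ) + φ s + ψ s ∧
    (Algebra.norm ℚ s : ℂ) = (s : ℝ) * φ s * ψ s := by
  classical
  have hu : (Finset.univ : Finset (K →+* ℂ)) = {algebraMap K ℂ, φ, ψ} := by
    symm
    apply Finset.eq_univ_of_card
    rw [Embeddings.card, h3, Finset.card_eq_three]
    exact ⟨_, _, _, h1, h2, h12, rfl⟩
  have ht := trace_eq_sum_embeddings (K := ℚ) (L := K) ℂ (x := s)
  have hn := Algebra.norm_eq_prod_embeddings ℚ ℂ s
  have e1 : ∑ σ : K →ₐ[ℚ] ℂ, σ s = ∑ σ : K →+* ℂ, σ s :=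
    Fintype.sum_equiv (RingHom.equivRatAlgHom K ℂ).symm _ _ fun σ => rfl
  have e2 : ∏ σ : K →ₐ[ℚ] ℂ, σ s = ∏ σ : K →+* ℂ, σ s :=
    Fintype.prod_equiv (RingHom.equivRatAlgHom K ℂ).symm _ _ fun σ => rfl
  have e0 : algebraMap K ℂ s = ((s : ℝ) : ℂ) := rfl
  rw [e1, hu, Finset.sum_insert (by simp [h1, h2]), Finset.sum_insert (by simp [h12]),
    Finset.sum_singleton, e0] at ht
  rw [e2, hu, Finset.prod_insert (by simp [h1, h2]), Finset.prod_insert (by simp [h12]),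
    Finset.prod_singleton, e0] at hn
  constructor
  · rw [add_assoc, ← ht]; simp
  · rw [mul_assoc, ← hn]; simp

theorem eq_zero_of_combination_eq_zero
    (hspan : Submodule.span ℚ (Set.range ![(1 : K), α 0, α 1]) = ⊤)
    {φ ψ : K →+* ℂ} (h1 : algebraMap K ℂ ≠ φ) (h2 : algebraMap K ℂ ≠ ψ) (h12 : φ ≠ ψ)
    {u v : ℂ} (h : ∀ i, u * ((α i : ℝ) - φ (α i)) + v * ((α i : ℝ) - ψ (α i)) = 0) :
    u = 0 ∧ v = 0 := by
  have hli := (linearIndependent_monoidHom K ℂ).comp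
    ![((algebraMap K ℂ : K →+* ℂ) : K →* ℂ), φ, ψ] (by
      have hinj : Function.Injective (fun f : K →+* ℂ => (f : K →* ℂ)) :=
        RingHom.coe_monoidHom_injective
      intro i j hij
      fin_cases i <;> fin_cases j <;> first | rfl | exfalso
      · exact h1 (hinj hij)
      · exact h2 (hinj hij)
      · exact h1 (hinj hij.symm)
      · exact h12 (hinj hij)
      · exact h2 (hinj hij.symm)
      · exact h12 (hinj hij.symm))
  rw [Fintype.linearIndependent_iff] at hli
  -- The combination `(u + v) id - u φ - v ψ` vanishes at 1, and by hypothesis at both `α i`, hence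
  -- on all of `K`; Dedekind's independence of characters applies.
  have key := hli ![u + v, -u, -v] (by
    funext x
    obtain ⟨a, b, c, rfl⟩ := exists_eq_rat_combination hspan x
    have e : ∀ χ : K →+* ℂ, χ (algebraMap ℚ K a + b • α 0 + c • α 1) =
        a + b * χ (α 0) + c * χ (α 1) := fun χ => by
      simp [Algebra.smul_def]
    have e0 : ∀ i, algebraMap K ℂ (α i) = ((α i : ℝ) : ℂ) := fun i => rfl
    simp only [Fin.sum_univ_three, Function.comp, Pi.add_apply, Pi.smul_apply, Pi.zero_apply,
      Matrix.cons_val_zero, Matrix.cons_val_one, Matrix.cons_val_two, Matrix.head_cons,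
      Matrix.tail_cons, smul_eq_mul, MonoidHom.coe_coe, e, e0]
    linear_combination b * h 0 + c * h 1)
  have k1 := key 1
  have k2 := key 2
  simp at k1 k2
  exact ⟨k1, k2⟩

theorem exists_unit_dominant [NumberField K]
    (hindep : LinearIndependent ℚ ![(1 : K), α 0, α 1])
    (hspan : Submodule.span ℚ (Set.range ![(1 : K), α 0, α 1]) = ⊤) (w : InfinitePlace K) :
    ∃ u : (𝓞 K)ˣ, (∀ w', w' ≠ w → w' (u : K) < 1) ∧
      ∀ s ∈ traceDual K (Submodule.span ℤ (Set.range ![(1 : K), α 0, α 1])),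
        (u : K) * s ∈ traceDual K (Submodule.span ℤ (Set.range ![(1 : K), α 0, α 1])) ∧
        ((u⁻¹ : (𝓞 K)ˣ) : K) * s ∈
            traceDual K (Submodule.span ℤ (Set.range ![(1 : K), α 0, α 1])) := by
  obtain ⟨u, hu⟩ := Units.dirichletUnitTheorem.exists_unit K w
  obtain ⟨k, hk, h⟩ := exists_unit_pow_smul_mem hindep hspan u
  refine ⟨u ^ k, fun w' hw' => ?_, h⟩
  have h1 : w' (u : K) < 1 := by
    by_contra hlt
    exact absurd (hu w' hw') (not_lt.2 (Real.log_nonneg (not_lt.1 hlt)))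
  have : ((u ^ k : (𝓞 K)ˣ) : K) = (u : K) ^ k := by simp
  rw [this, map_pow]
  exact pow_lt_one₀ (apply_nonneg _ _) h1 hk

theorem sq_unit_norm_eq_one [NumberField K] (u : (𝓞 K)ˣ) :
    Algebra.norm ℚ ((u : K) ^ 2) = 1 := by
  rw [map_pow, ← sq_abs, NumberField.Units.norm, one_pow]

end Embeddings

/-! ### Accumulation points: large denominators and connected curves -/

section Accumulation

variable {d : ℕ}

/-- Since `|q| ^ η ≥ 1`, a bound on `q` and on the normalized error also bounds `p`. Only finitely
many such points exist, while every neighbourhood of an accumulation point holds infinitely many. -/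
theorem exists_large_denominator_of_mem_accumulationSet {η : ℝ} (hη : 0 ≤ η) {α x : Fin d → ℝ}
    (hx : x ∈ accumulationSet η α) (B : ℕ) {τ : ℝ} (hτ : 0 < τ) :
    ∃ (q : ℤ) (p : Fin d → ℤ), (B : ℝ) < |(q : ℝ)| ∧
      dist (|(q : ℝ)| ^ η • ((q : ℝ) • α - fun i => (p i : ℝ))) x < τ := by
  by_contra! hcon
  have hacc : AccPt x (𝓟 (Metric.ball x τ ∩ normalizedApproximations η α)) :=
    AccPt.nhds_inter hx (Metric.ball_mem_nhds x hτ)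
  refine Set.Infinite.of_accPt hacc ?_
  obtain ⟨N, hN⟩ := exists_nat_ge ((B : ℝ) * ‖α‖ + ‖x‖ + τ)
  refine (((Set.finite_Icc (-B : ℤ) B).prod
    (Set.Finite.pi' fun _ : Fin d => Set.finite_Icc (-N : ℤ) N)).image
    fun z => |(z.1 : ℝ)| ^ η • ((z.1 : ℝ) • α - fun i => (z.2 i : ℝ))).subset ?_
  rintro _ ⟨hball, q, p, hq, rfl⟩
  have hqB : |(q : ℝ)| ≤ B := by
    by_contra! h
    exact absurd (hcon q p h) (not_le.2 hball)
  have hp : ∀ i, |(p i : ℝ)| ≤ N := fun i => by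
    set v : Fin d → ℝ := (q : ℝ) • α - fun i => (p i : ℝ) with hv
    have h1 : ‖v‖ ≤ ‖|(q : ℝ)| ^ η • v‖ := by
      rw [norm_smul]
      refine le_mul_of_one_le_left (norm_nonneg _) ((Real.one_le_rpow ?_ hη).trans
        (le_abs_self _))
      exact_mod_cast Int.one_le_abs hq
    have h2 : ‖|(q : ℝ)| ^ η • v‖ ≤ ‖x‖ + τ := by
      have := norm_le_norm_add_norm_sub' (|(q : ℝ)| ^ η • v) x
      rw [← dist_eq_norm] at this
      linarith [Metric.mem_ball.1 hball]
    have h3 : (p i : ℝ) = q * α i - v i := by simp [hv]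
    have h4 : |q * α i| ≤ B * ‖α‖ := by
      rw [abs_mul]
      exact mul_le_mul hqB (norm_le_pi_norm α i) (abs_nonneg _) (Nat.cast_nonneg _)
    have h5 : |v i| ≤ ‖v‖ := norm_le_pi_norm v i
    rw [h3]
    linarith [abs_sub (q * α i) (v i)]
  refine ⟨(q, p), ⟨⟨?_, ?_⟩, fun i => ⟨?_, ?_⟩⟩, rfl⟩
  · exact_mod_cast (abs_le.1 hqB).1
  · exact_mod_cast (abs_le.1 hqB).2
  · exact_mod_cast (abs_le.1 (hp i)).1
  · exact_mod_cast (abs_le.1 (hp i)).2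

/-- A connected set with two points has no isolated point, and passing to the closure does not
change the derived set. -/
theorem subset_accumulationSet_of_subset_closure {η : ℝ} {α : Fin d → ℝ} {S : Set (Fin d → ℝ)}
    (hS : IsPreconnected S) (hS' : S.Nontrivial)
    (h : S ⊆ closure (normalizedApproximations η α)) : S ⊆ accumulationSet η α := by
  rw [accumulationSet, ← derivedSet_closure]
  exact (preperfect_iff_subset_derivedSet.1 (hS.preperfect_of_nontrivial hS')).trans
    (derivedSet_mono _ _ h)

end Accumulation

/-- Real coordinates `conj` for the pair of nontrivial conjugates of elements of a cubic field,
in which the approximation errors are linear and the norm form is the product of the element with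
a quadratic form. -/
structure ConjugateModel (K : IntermediateField ℚ ℝ) (α : Fin 2 → K) where
  conj : K → Fin 2 → ℝ
  error : (Fin 2 → ℝ) ≃ₗ[ℝ] (Fin 2 → ℝ)
  traceRest : (Fin 2 → ℝ) →ₗ[ℝ] ℝ
  form : (Fin 2 → ℝ) → ℝ
  continuous_form : Continuous form
  form_smul : ∀ (c : ℝ) (y : Fin 2 → ℝ), form (c • y) = c ^ 2 * form y
  error_conj : ∀ (s : K) (i : Fin 2),
    error (conj s) i = (Algebra.trace ℚ K s : ℝ) * α i - (Algebra.trace ℚ K (s * α i) : ℝ)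
  trace_eq : ∀ s : K, (Algebra.trace ℚ K s : ℝ) = s + traceRest (conj s)
  norm_eq : ∀ s : K, (Algebra.norm ℚ s : ℝ) = s * form (conj s)

/-! ### Limits in conjugate coordinates -/

namespace ConjugateModel

variable {K : IntermediateField ℚ ℝ} {α : Fin 2 → K} (M : ConjugateModel K α)

theorem continuous_error : Continuous M.error :=
  M.error.toLinearMap.continuous_of_finiteDimensional

theorem continuous_error_symm : Continuous M.error.symm :=
  M.error.symm.toLinearMap.continuous_of_finiteDimensional

theorem continuous_traceRest : Continuous M.traceRest :=
  M.traceRest.continuous_of_finiteDimensional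

theorem form_zero : M.form 0 = 0 := by
  simpa using M.form_smul 0 0

theorem form_sqrt_smul {a : ℝ} (ha : 0 ≤ a) (y : Fin 2 → ℝ) :
    M.form (√a • y) = a * M.form y := by
  rw [M.form_smul, Real.sq_sqrt ha]

theorem norm_abs_eq (s : K) : |(Algebra.norm ℚ s : ℝ)| = |(s : ℝ)| * |M.form (M.conj s)| := by
  rw [M.norm_eq, abs_mul]

theorem exists_int_cast_eq [FiniteDimensional ℚ K]
    (hindep : LinearIndependent ℚ ![(1 : K), α 0, α 1])
    (hspan : Submodule.span ℚ (Set.range ![(1 : K), α 0, α 1]) = ⊤) :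
    ∃ D : ℤ, D ≠ 0 ∧ ∀ s ∈ traceDual K (Submodule.span ℤ (Set.range ![(1 : K), α 0, α 1])),
      ∃ n : ℤ, (D : ℝ) * (|(s : ℝ)| * M.form (M.conj s)) = n := by
  obtain ⟨D, hD, h⟩ := exists_norm_denominator hindep hspan
  refine ⟨D, hD, fun s hs => ?_⟩
  obtain ⟨n, hn⟩ := h s hs
  have hn' : (D : ℝ) * (s * M.form (M.conj s)) = n := by
    rw [← M.norm_eq]; exact_mod_cast hn
  rcases abs_choice (s : ℝ) with h | h
  · exact ⟨n, by rw [h, hn']⟩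
  · exact ⟨-n, by rw [h]; push_cast; linarith⟩

theorem tendsto_conj_zero {ι : Type*} {l : Filter ι} {r : ι → ℝ} {s : ι → K} {y : Fin 2 → ℝ}
    (hr : Tendsto r l atTop) (h : Tendsto (fun n => √(r n) • M.conj (s n)) l (𝓝 y)) :
    Tendsto (fun n => M.conj (s n)) l (𝓝 0) := by
  have h1 : Tendsto (fun n => (√(r n))⁻¹) l (𝓝 0) :=
    tendsto_inv_atTop_zero.comp (Real.tendsto_sqrt_atTop.comp hr)
  have h2 := h1.smul h
  rw [zero_smul] at h2
  refine h2.congr' ?_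
  filter_upwards [hr.eventually_gt_atTop 0] with n hn
  rw [inv_smul_smul₀ (Real.sqrt_pos.2 hn).ne']

/-- This is the inclusion of the accumulation set in the curves: the values `|s| · form (conj s)`
are `± N(s)`, converge to the form at the limit point, and are discrete. -/
theorem exists_form_eq_of_mem_accumulationSet [FiniteDimensional ℚ K]
    (hindep : LinearIndependent ℚ ![(1 : K), α 0, α 1])
    (hspan : Submodule.span ℚ (Set.range ![(1 : K), α 0, α 1]) = ⊤) {x : Fin 2 → ℝ}
    (hx : x ∈ accumulationSet (1 / 2) (fun i => (α i : ℝ))) :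
    ∃ s ∈ traceDual K (Submodule.span ℤ (Set.range ![(1 : K), α 0, α 1])), s ≠ 0 ∧
      M.form (M.error.symm x) = |(s : ℝ)| * M.form (M.conj s) := by
  have key : ∀ n : ℕ, ∃ s ∈ traceDual K (Submodule.span ℤ (Set.range ![(1 : K), α 0, α 1])),
      (n : ℝ) < |(Algebra.trace ℚ K s : ℝ)| ∧
      dist (√|(Algebra.trace ℚ K s : ℝ)| • M.error (M.conj s)) x < 1 / ((n : ℝ) + 1) := by
    intro n
    obtain ⟨q, p, hq, hd⟩ := exists_large_denominator_of_mem_accumulationSet (by norm_num) hx n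
      (Nat.one_div_pos_of_nat (α := ℝ) (n := n))
    obtain ⟨s, hs, hs'⟩ := exists_trace_eq hindep hspan q (fun i => p i)
    refine ⟨s, (mem_traceDual_span_iff s).2 ⟨⟨q, hs⟩, fun i => ⟨p i, hs' i⟩⟩, ?_, ?_⟩
    · simpa [hs] using hq
    · convert hd using 2
      rw [Real.sqrt_eq_rpow, hs]
      congr 1
      ext i
      rw [M.error_conj, hs, hs']
      simp
  choose s hs hlarge hdist using key
  have hq : Tendsto (fun n => |(Algebra.trace ℚ K (s n) : ℝ)|) atTop atTop :=
    tendsto_atTop_mono (fun n => (hlarge n).le) tendsto_natCast_atTop_atTop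
  have hX : Tendsto (fun n => √|(Algebra.trace ℚ K (s n) : ℝ)| • M.error (M.conj (s n)))
      atTop (𝓝 x) := by
    rw [tendsto_iff_dist_tendsto_zero]
    exact squeeze_zero (fun _ => dist_nonneg) (fun n => (hdist n).le)
      tendsto_one_div_add_atTop_nhds_zero_nat
  have hY : Tendsto (fun n => √|(Algebra.trace ℚ K (s n) : ℝ)| • M.conj (s n))
      atTop (𝓝 (M.error.symm x)) := by
    have := (M.continuous_error_symm.tendsto x).comp hX
    simpa [Function.comp_def] using this
  have hΦ := M.tendsto_conj_zero hq hY
  have hT : Tendsto (fun n => M.traceRest (M.conj (s n))) atTop (𝓝 0) := by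
    simpa [Function.comp_def] using (M.continuous_traceRest.tendsto 0).comp hΦ
  have hF0 : Tendsto (fun n => M.form (M.conj (s n))) atTop (𝓝 0) := by
    simpa [Function.comp_def, M.form_zero] using (M.continuous_form.tendsto 0).comp hΦ
  have hF : Tendsto (fun n => |(Algebra.trace ℚ K (s n) : ℝ)| * M.form (M.conj (s n)))
      atTop (𝓝 (M.form (M.error.symm x))) := by
    have := (M.continuous_form.tendsto _).comp hY
    simpa [Function.comp_def, M.form_sqrt_smul] using this
  -- The trace differs from `s` only by `traceRest (conj s)`, which tends to zero.
  have habs : Tendsto (fun n => |(s n : ℝ)| - |(Algebra.trace ℚ K (s n) : ℝ)|) atTop (𝓝 0) := by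
    refine squeeze_zero_norm (fun n => ?_) (by simpa using hT.abs)
    rw [Real.norm_eq_abs]
    refine (abs_abs_sub_abs_le_abs_sub _ _).trans ?_
    rw [M.trace_eq, sub_add_cancel_left, abs_neg]
  have hlim : Tendsto (fun n => |(s n : ℝ)| * M.form (M.conj (s n)))
      atTop (𝓝 (M.form (M.error.symm x))) := by
    have := hF.add (habs.mul hF0)
    simp only [mul_zero, add_zero] at this
    exact this.congr fun n => by ring
  obtain ⟨D, hD, hint⟩ := M.exists_int_cast_eq hindep hspan
  choose m hm using fun n => hint (s n) (hs n)
  have hlim' : Tendsto (fun n => (m n : ℝ)) atTop (𝓝 (D * M.form (M.error.symm x))) :=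
    (hlim.const_mul (D : ℝ)).congr hm
  -- A convergent sequence of integers is eventually constant, so the limit is attained by an actual
  -- `s n`.
  obtain ⟨z, hz⟩ : D * M.form (M.error.symm x) ∈ Set.range ((↑) : ℤ → ℝ) :=
    Int.isClosedEmbedding_coe_real.isClosed_range.mem_of_tendsto hlim'
      (Eventually.of_forall fun n => ⟨m n, rfl⟩)
  rw [← hz] at hlim'
  have hmz := Int.isClosedEmbedding_coe_real.isEmbedding.tendsto_nhds_iff.2 hlim'
  rw [nhds_discrete, tendsto_pure] at hmz
  have hbig : ∀ᶠ n in atTop, 0 < |(s n : ℝ)| := by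
    filter_upwards [hq.eventually_ge_atTop 1, habs.eventually (eventually_gt_nhds
      (show (-1 : ℝ) < 0 by norm_num))] with n h1 h2
    linarith
  obtain ⟨n, hn, hn'⟩ := (hmz.and hbig).exists
  refine ⟨s n, hs n, fun h0 => by simp [h0] at hn', ?_⟩
  have hD' : (D : ℝ) ≠ 0 := by exact_mod_cast hD
  refine mul_left_cancel₀ hD' ?_
  rw [← hz, hm, hn]

/-- Approximations are normalized by `|Tr s|`, but it suffices to normalize by `|s|`: the ratio
tends to 1 once the other conjugates vanish in the limit. -/
theorem error_mem_closure
    {y : Fin 2 → ℝ}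
    (h : ∀ (B : ℕ) (τ : ℝ), 0 < τ →
      ∃ s ∈ traceDual K (Submodule.span ℤ (Set.range ![(1 : K), α 0, α 1])),
        (B : ℝ) < |(s : ℝ)| ∧ dist (√|(s : ℝ)| • M.conj s) y < τ) :
    M.error y ∈ closure (normalizedApproximations (1 / 2) (fun i => (α i : ℝ))) := by
  choose s hs hlarge hdist using fun n : ℕ => h n _ (Nat.one_div_pos_of_nat (α := ℝ) (n := n))
  have hq : Tendsto (fun n => |(s n : ℝ)|) atTop atTop :=
    tendsto_atTop_mono (fun n => (hlarge n).le) tendsto_natCast_atTop_atTop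
  have hY : Tendsto (fun n => √|(s n : ℝ)| • M.conj (s n)) atTop (𝓝 y) := by
    rw [tendsto_iff_dist_tendsto_zero]
    exact squeeze_zero (fun _ => dist_nonneg) (fun n => (hdist n).le)
      tendsto_one_div_add_atTop_nhds_zero_nat
  have hΦ := M.tendsto_conj_zero hq hY
  have hT : Tendsto (fun n => M.traceRest (M.conj (s n))) atTop (𝓝 0) := by
    simpa [Function.comp_def] using (M.continuous_traceRest.tendsto 0).comp hΦ
  have hdiff : Tendsto (fun n => |(Algebra.trace ℚ K (s n) : ℝ)| - |(s n : ℝ)|) atTop (𝓝 0) := by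
    refine squeeze_zero_norm (fun n => ?_) (by simpa using hT.abs)
    rw [Real.norm_eq_abs]
    refine (abs_abs_sub_abs_le_abs_sub _ _).trans ?_
    rw [M.trace_eq, add_sub_cancel_left]
  have hratio : Tendsto (fun n => |(Algebra.trace ℚ K (s n) : ℝ)| / |(s n : ℝ)|) atTop (𝓝 1) := by
    have := (hdiff.mul (tendsto_inv_atTop_zero.comp hq)).add_const 1
    simp only [mul_zero, zero_add] at this
    refine this.congr' ?_
    filter_upwards [hq.eventually_gt_atTop 0] with n hn
    simp only [Function.comp]
    field_simp
    ring
  have hX : Tendsto (fun n => M.error (√|(Algebra.trace ℚ K (s n) : ℝ)| • M.conj (s n))) atTop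
      (𝓝 (M.error y)) := by
    refine (M.continuous_error.tendsto y).comp ?_
    have := ((Real.continuous_sqrt.tendsto 1).comp hratio).smul hY
    rw [Real.sqrt_one, one_smul] at this
    refine this.congr' ?_
    filter_upwards [hq.eventually_gt_atTop 0] with n hn
    rw [Function.comp, smul_smul, Real.sqrt_div (abs_nonneg _),
      div_mul_cancel₀ _ (Real.sqrt_pos.2 hn).ne']
  refine mem_closure_of_tendsto hX ?_
  -- From `|s| > 1` and `|Tr s| > |s| - 1` the denominator `q = Tr s` is nonzero.
  filter_upwards [hq.eventually_gt_atTop 1, hdiff.eventually (eventually_gt_nhds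
      (show (-1 : ℝ) < 0 by norm_num))] with n h1 h2
  obtain ⟨⟨q, hq⟩, hp⟩ := (mem_traceDual_span_iff (s n)).1 (hs n)
  choose p hp using hp
  refine ⟨q, p, ?_, ?_⟩
  · rintro rfl
    simp [hq] at h2
    linarith
  · rw [map_smul, Real.sqrt_eq_rpow, hq]
    congr 1
    ext i
    rw [M.error_conj, hq, hp]
    simp

theorem error_mem_accumulationSet {γ : ℝ → Fin 2 → ℝ} (hγ : Continuous γ) {a b : ℝ}
    (hab : γ a ≠ γ b)
    (h : ∀ t, M.error (γ t) ∈
      closure (normalizedApproximations (1 / 2) (fun i => (α i : ℝ)))) (t : ℝ) :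
    M.error (γ t) ∈ accumulationSet (1 / 2) (fun i => (α i : ℝ)) := by
  refine subset_accumulationSet_of_subset_closure
    (S := Set.range fun t => M.error (γ t))
    (isPreconnected_range (M.continuous_error.comp hγ))
    ⟨_, ⟨a, rfl⟩, _, ⟨b, rfl⟩, fun heq => hab (M.error.injective heq)⟩ ?_ ⟨t, rfl⟩
  rintro _ ⟨t, rfl⟩
  exact h t

end ConjugateModel

/-! ### Positive norm-one units acting on the dual lattice -/

section Units

variable {K : IntermediateField ℚ ℝ} {α : Fin 2 → K}

/-- Squaring a Dirichlet unit makes its norm 1 and all its real conjugates positive; `e'` is the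
inverse. -/
theorem exists_pos_unit_dominant [NumberField K]
    (hindep : LinearIndependent ℚ ![(1 : K), α 0, α 1])
    (hspan : Submodule.span ℚ (Set.range ![(1 : K), α 0, α 1]) = ⊤) (w : InfinitePlace K) :
    ∃ e e' : K, e * e' = 1 ∧ Algebra.norm ℚ e = 1 ∧ Algebra.norm ℚ e' = 1 ∧
      (∀ ρ : K →+* ℝ, 0 < ρ e ∧ 0 < ρ e') ∧ (∀ w', w' ≠ w → w' e < 1) ∧
      ∀ s ∈ traceDual K (Submodule.span ℤ (Set.range ![(1 : K), α 0, α 1])),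
        e * s ∈ traceDual K (Submodule.span ℤ (Set.range ![(1 : K), α 0, α 1])) ∧
        e' * s ∈ traceDual K (Submodule.span ℤ (Set.range ![(1 : K), α 0, α 1])) := by
  obtain ⟨u, hu, hΛ⟩ := exists_unit_dominant hindep hspan w
  have h1 : (u : K) * ((u⁻¹ : (𝓞 K)ˣ) : K) = 1 := by
    rw [← Units.coe_mul, mul_inv_cancel, Units.coe_one]
  refine ⟨(u : K) ^ 2, ((u⁻¹ : (𝓞 K)ˣ) : K) ^ 2, by rw [← mul_pow, h1, one_pow],
    sq_unit_norm_eq_one u, sq_unit_norm_eq_one u⁻¹, fun ρ => ⟨?_, ?_⟩, fun w' hw' => ?_,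
    fun s hs => ⟨?_, ?_⟩⟩
  · rw [map_pow]
    exact sq_pos_of_ne_zero ((map_ne_zero ρ).2 (left_ne_zero_of_mul_eq_one h1))
  · rw [map_pow]
    exact sq_pos_of_ne_zero ((map_ne_zero ρ).2 (right_ne_zero_of_mul_eq_one h1))
  · rw [map_pow]
    exact pow_lt_one₀ (apply_nonneg _ _) (hu w' hw') two_ne_zero
  · rw [sq, mul_assoc]
    exact (hΛ _ (hΛ _ hs).1).1
  · rw [sq, mul_assoc]
    exact (hΛ _ (hΛ _ hs).2).2

theorem pow_mul_mem {Λ : Submodule ℤ K} {e : K} (he : ∀ s ∈ Λ, e * s ∈ Λ) {s : K} (hs : s ∈ Λ)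
    (n : ℕ) : e ^ n * s ∈ Λ := by
  induction n with
  | zero => simpa using hs
  | succ n ih => rw [pow_succ', mul_assoc]; exact he _ ih

end Units

/-! ### Conjugate coordinates in the real and the complex case -/

section Models

/-- The linear automorphism of the plane with prescribed linearly independent columns. -/
noncomputable def planeEquiv (a b : Fin 2 → ℝ)
    (h : ∀ u v : ℝ, (∀ i, u * a i + v * b i = 0) → u = 0 ∧ v = 0) :
    (Fin 2 → ℝ) ≃ₗ[ℝ] (Fin 2 → ℝ) :=
  LinearEquiv.ofInjectiveEndo
    ((LinearMap.proj (R := ℝ) (φ := fun _ : Fin 2 => ℝ) 0).smulRight a +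
      (LinearMap.proj (R := ℝ) (φ := fun _ : Fin 2 => ℝ) 1).smulRight b) (by
    rw [← LinearMap.ker_eq_bot, LinearMap.ker_eq_bot']
    intro y hy
    obtain ⟨h0, h1⟩ := h (y 0) (y 1) fun i => by simpa using congrFun hy i
    ext i
    fin_cases i
    · exact h0
    · exact h1)

theorem planeEquiv_apply (a b : Fin 2 → ℝ)
    (h : ∀ u v : ℝ, (∀ i, u * a i + v * b i = 0) → u = 0 ∧ v = 0) (y : Fin 2 → ℝ) (i : Fin 2) :
    planeEquiv a b h y i = y 0 * a i + y 1 * b i := by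
  rfl

variable {K : IntermediateField ℚ ℝ} {α : Fin 2 → K}

/-- The model of a totally real cubic field by its two nontrivial real embeddings. -/
noncomputable def realModel (σ τ : K →+* ℝ)
    (hTN : ∀ s : K, (Algebra.trace ℚ K s : ℝ) = s + σ s + τ s ∧
      (Algebra.norm ℚ s : ℝ) = s * σ s * τ s)
    (h : ∀ u v : ℝ, (∀ i, u * (α i - σ (α i)) + v * (α i - τ (α i)) = 0) → u = 0 ∧ v = 0) :
    ConjugateModel K α where
  conj s := ![σ s, τ s]
  error := planeEquiv (fun i => α i - σ (α i)) (fun i => α i - τ (α i)) h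
  traceRest := LinearMap.proj (R := ℝ) (φ := fun _ : Fin 2 => ℝ) 0 +
    LinearMap.proj (R := ℝ) (φ := fun _ : Fin 2 => ℝ) 1
  form y := y 0 * y 1
  continuous_form := by fun_prop
  form_smul c y := by simp; ring
  error_conj s i := by
    rw [planeEquiv_apply, (hTN _).1, (hTN _).1]
    simp
    ring
  trace_eq s := by
    rw [(hTN _).1, add_assoc]
    rfl
  norm_eq s := by
    rw [(hTN _).2]
    simp
    ring

/-- The model of a complex cubic field by the real and imaginary part of a complex embedding. -/
noncomputable def complexModel (φ : K →+* ℂ)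
    (hTN : ∀ s : K, (Algebra.trace ℚ K s : ℝ) = s + 2 * (φ s).re ∧
      (Algebra.norm ℚ s : ℝ) = s * ((φ s).re ^ 2 + (φ s).im ^ 2))
    (h : ∀ u v : ℝ, (∀ i, u * (2 * (α i - (φ (α i)).re)) + v * (2 * (φ (α i)).im) = 0) →
      u = 0 ∧ v = 0) :
    ConjugateModel K α where
  conj s := ![(φ s).re, (φ s).im]
  -- The two conjugate embeddings contribute `2 Re (φ s (αᵢ - φ αᵢ))`, written in `Re (φ s)` and `Im
  -- (φ s)`.
  error := planeEquiv (fun i => 2 * (α i - (φ (α i)).re)) (fun i => 2 * (φ (α i)).im) h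
  traceRest := (2 : ℝ) • LinearMap.proj 0
  form y := y 0 ^ 2 + y 1 ^ 2
  continuous_form := by fun_prop
  form_smul c y := by simp; ring
  error_conj s i := by
    rw [planeEquiv_apply, (hTN _).1, (hTN _).1]
    simp
    ring
  trace_eq s := by
    rw [(hTN _).1]
    simp
  norm_eq s := by
    rw [(hTN _).2]
    simp

end Models

/-! ### Totally real case: density along hyperbolas -/

section RealApproximation

variable {K : IntermediateField ℚ ℝ} {α : Fin 2 → K}

/-- For norm 1 the scaled conjugates `√e σ e` and `√e τ e` have product 1, so each unit is a
hyperbolic rotation by `a` or `c`. Opposite signs let both exponents stay nonnegative, keeping the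
real value large. -/
theorem exists_pos_units_of_totallyReal [NumberField K]
    (hindep : LinearIndependent ℚ ![(1 : K), α 0, α 1])
    (hspan : Submodule.span ℚ (Set.range ![(1 : K), α 0, α 1]) = ⊤) {σ τ : K →+* ℝ}
    (h1 : algebraMap K ℝ ≠ σ) (h2 : algebraMap K ℝ ≠ τ) (h12 : σ ≠ τ)
    (hN : ∀ s : K, (Algebra.norm ℚ s : ℝ) = s * σ s * τ s) :
    ∃ (e d : K) (a c : ℝ), (1 : ℝ) < e ∧ (1 : ℝ) < d ∧
      Algebra.norm ℚ e = 1 ∧ Algebra.norm ℚ d = 1 ∧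
      √e * σ e = Real.exp a ∧ √e * τ e = Real.exp (-a) ∧
      √d * σ d = Real.exp c ∧ √d * τ d = Real.exp (-c) ∧ a * c < 0 ∧
      ∀ s ∈ traceDual K (Submodule.span ℤ (Set.range ![(1 : K), α 0, α 1])),
        e * s ∈ traceDual K (Submodule.span ℤ (Set.range ![(1 : K), α 0, α 1])) ∧
        d * s ∈ traceDual K (Submodule.span ℤ (Set.range ![(1 : K), α 0, α 1])) := by
  have h3 := finrank_eq_three hindep hspan
  let pl : (K →+* ℝ) → InfinitePlace K := fun ρ => InfinitePlace.mk (Complex.ofRealHom.comp ρ)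
  have hpl : ∀ ρ x, pl ρ x = |ρ x| := fun ρ x => by
    simp [pl, InfinitePlace.apply]
  have hplne : ∀ ρ ρ' : K →+* ℝ, ρ ≠ ρ' → pl ρ ≠ pl ρ' := fun ρ ρ' hne heq => by
    refine hne (RingHom.ext fun x => ?_)
    rcases InfinitePlace.mk_eq_iff.1 heq with h | h
    · have := congrArg (fun f : K →+* ℂ => f x) h
      simpa using this
    · have := congrArg (fun f : K →+* ℂ => f x) h
      simpa [ComplexEmbedding.conjugate_coe_eq] using this
  have hdom : ∀ ρ : K →+* ℝ, ∃ e e' : K, e * e' = 1 ∧ Algebra.norm ℚ e = 1 ∧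
      Algebra.norm ℚ e' = 1 ∧
      (∀ ρ : K →+* ℝ, 0 < ρ e ∧ 0 < ρ e') ∧ (∀ ρ', ρ' ≠ ρ → ρ' e < 1) ∧
      ∀ s ∈ traceDual K (Submodule.span ℤ (Set.range ![(1 : K), α 0, α 1])),
        e * s ∈ traceDual K (Submodule.span ℤ (Set.range ![(1 : K), α 0, α 1])) ∧
        e' * s ∈ traceDual K (Submodule.span ℤ (Set.range ![(1 : K), α 0, α 1])) := fun ρ => by
    obtain ⟨e, e', hee, hNe, hNe', hpos, hlt, hΛ⟩ := exists_pos_unit_dominant hindep hspan (pl ρ)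
    refine ⟨e, e', hee, hNe, hNe', hpos, fun ρ' hρ' => ?_, hΛ⟩
    have := hlt _ (hplne _ _ hρ')
    rw [hpl] at this
    exact (le_abs_self _).trans_lt this
  have hexp : ∀ x : K, (∀ ρ : K →+* ℝ, 0 < ρ x) → Algebra.norm ℚ x = 1 →
      √x * σ x = Real.exp (Real.log (√x * σ x)) ∧
      √x * τ x = Real.exp (-Real.log (√x * σ x)) := fun x hx hNx => by
    have hx0 : (0 : ℝ) < x := hx (algebraMap K ℝ)
    have hs : 0 < √(x : ℝ) := Real.sqrt_pos.2 hx0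
    have hpos : 0 < √(x : ℝ) * σ x := mul_pos hs (hx σ)
    refine ⟨(Real.exp_log hpos).symm, ?_⟩
    rw [Real.exp_neg, Real.exp_log hpos]
    refine eq_inv_of_mul_eq_one_right ?_
    have := hN x
    rw [hNx] at this
    calc √(x : ℝ) * σ x * (√x * τ x) = (√(x : ℝ) * √(x : ℝ)) * σ x * τ x := by ring
      _ = 1 := by rw [Real.mul_self_sqrt hx0.le, ← this]; simp
  have hlog_pos : ∀ x : K, (∀ ρ : K →+* ℝ, 0 < ρ x) → Algebra.norm ℚ x = 1 → τ x < σ x →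
      0 < Real.log (√x * σ x) := fun x hx hNx hlt => by
    obtain ⟨ha, hb⟩ := hexp x hx hNx
    have hs : 0 < √(x : ℝ) := Real.sqrt_pos.2 (hx (algebraMap K ℝ))
    have := mul_lt_mul_of_pos_left hlt hs
    rw [ha, hb, Real.exp_lt_exp] at this
    linarith
  have hlog_neg : ∀ x : K, (∀ ρ : K →+* ℝ, 0 < ρ x) → Algebra.norm ℚ x = 1 → σ x < τ x →
      Real.log (√x * σ x) < 0 := fun x hx hNx hlt => by
    obtain ⟨ha, hb⟩ := hexp x hx hNx
    have hs : 0 < √(x : ℝ) := Real.sqrt_pos.2 (hx (algebraMap K ℝ))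
    have := mul_lt_mul_of_pos_left hlt hs
    rw [ha, hb, Real.exp_lt_exp] at this
    linarith
  obtain ⟨e, _, -, hNe, -, hpose, hlte, hΛe⟩ := hdom (algebraMap K ℝ)
  have he1 : (1 : ℝ) < e := by
    have hn := hN e
    rw [hNe] at hn
    have hσ := hlte σ h1.symm
    have hτ := hlte τ h2.symm
    have h0 : (0 : ℝ) < e := (hpose (algebraMap K ℝ)).1
    have hσ0 := (hpose σ).1
    have hτ0 := (hpose τ).1
    by_contra! hle
    have hlt : σ e * τ e < 1 := mul_lt_one_of_nonneg_of_lt_one_left hσ0.le hσ hτ.le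
    have : (e : ℝ) * (σ e * τ e) < 1 :=
      mul_lt_one_of_nonneg_of_lt_one_right hle (by positivity) hlt
    rw [← mul_assoc, ← hn] at this
    simp at this
  have hne := embeddings_ne_of_one_lt_of_norm_eq_one h3 h12 he1 hNe
  obtain ⟨hae, hbe⟩ := hexp e (fun ρ => (hpose ρ).1) hNe
  -- The second unit is the inverse of one dominant at the place where `e` has the larger of its two
  -- other conjugates. This reverses the order of the conjugates, hence the sign of the logarithm.
  rcases lt_or_gt_of_ne hne with hlt | hlt
  · obtain ⟨v, d, hvd, -, hNd, hpos, hltv, hΛ⟩ := hdom τ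
    have hinv : ∀ ρ : K →+* ℝ, ρ ≠ τ → 1 < ρ d := fun ρ hρ => by
      have h := congrArg ρ hvd
      rw [map_mul, map_one] at h
      have := hltv ρ hρ
      have := (hpos ρ).2
      nlinarith
    have hd1 : (1 : ℝ) < d := hinv (algebraMap K ℝ) h2
    have hτ : τ d < σ d := by
      have hn := hN d
      rw [hNd] at hn
      have h5 := hinv σ h12
      have h6 := (hpos τ).2
      by_contra! hle
      have : (1 : ℝ) < d * σ d := one_lt_mul_of_lt_of_le hd1 h5.le
      have : 1 < d * σ d * τ d := one_lt_mul_of_lt_of_le this (h5.le.trans hle)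
      rw [← hn] at this
      simp at this
    obtain ⟨had, hbd⟩ := hexp d (fun ρ => (hpos ρ).2) hNd
    exact ⟨e, d, _, _, he1, hd1, hNe, hNd, hae, hbe, had, hbd,
      mul_neg_of_neg_of_pos (hlog_neg e (fun ρ => (hpose ρ).1) hNe hlt)
        (hlog_pos d (fun ρ => (hpos ρ).2) hNd hτ), fun s hs => ⟨(hΛe s hs).1, (hΛ s hs).2⟩⟩
  · obtain ⟨v, d, hvd, -, hNd, hpos, hltv, hΛ⟩ := hdom σ
    have hinv : ∀ ρ : K →+* ℝ, ρ ≠ σ → 1 < ρ d := fun ρ hρ => by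
      have h := congrArg ρ hvd
      rw [map_mul, map_one] at h
      have := hltv ρ hρ
      have := (hpos ρ).2
      nlinarith
    have hd1 : (1 : ℝ) < d := hinv (algebraMap K ℝ) h1
    have hτ : σ d < τ d := by
      have hn := hN d
      rw [hNd] at hn
      have h5 := hinv τ h12.symm
      have h6 := (hpos σ).2
      by_contra! hle
      have : (1 : ℝ) < d * σ d := one_lt_mul_of_lt_of_le hd1 (h5.le.trans hle)
      have : 1 < d * σ d * τ d := one_lt_mul_of_lt_of_le this h5.le
      rw [← hn] at this
      simp at this
    obtain ⟨had, hbd⟩ := hexp d (fun ρ => (hpos ρ).2) hNd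
    exact ⟨e, d, _, _, he1, hd1, hNe, hNd, hae, hbe, had, hbd,
      mul_neg_of_pos_of_neg (hlog_pos e (fun ρ => (hpose ρ).1) hNe hlt)
        (hlog_neg d (fun ρ => (hpos ρ).2) hNd hτ), fun s hs => ⟨(hΛe s hs).1, (hΛ s hs).2⟩⟩

theorem sqrt_pow_eq {x : ℝ} (hx : 0 ≤ x) (m : ℕ) : √(x ^ m) = √x ^ m := by
  rw [← Real.sqrt_sq (pow_nonneg (Real.sqrt_nonneg x) m), ← pow_mul, mul_comm m, pow_mul,
    Real.sq_sqrt hx]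

theorem sqrt_mul_map_pow (ρ : K →+* ℝ) {e : K} (he : (1 : ℝ) < e) (m : ℕ) :
    √((e ^ m : K) : ℝ) * ρ (e ^ m) = (√(e : ℝ) * ρ e) ^ m := by
  rw [map_pow, mul_pow]
  congr 1
  rw [← sqrt_pow_eq (by linarith)]
  simp

theorem exists_near_hyperbola_point [NumberField K]
    (hindep : LinearIndependent ℚ ![(1 : K), α 0, α 1])
    (hspan : Submodule.span ℚ (Set.range ![(1 : K), α 0, α 1]) = ⊤) {σ τ : K →+* ℝ}
    (h1 : algebraMap K ℝ ≠ σ) (h2 : algebraMap K ℝ ≠ τ) (h12 : σ ≠ τ)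
    (hN : ∀ s : K, (Algebra.norm ℚ s : ℝ) = s * σ s * τ s)
    {s : K} (hs : s ∈ traceDual K (Submodule.span ℤ (Set.range ![(1 : K), α 0, α 1])))
    (hs0 : s ≠ 0) {y : Fin 2 → ℝ} (hy : y 0 * y 1 = |(s : ℝ)| * (σ s * τ s))
    (B : ℕ) {ε : ℝ} (hε : 0 < ε) :
    ∃ z ∈ traceDual K (Submodule.span ℤ (Set.range ![(1 : K), α 0, α 1])),
      (B : ℝ) < |(z : ℝ)| ∧ dist (√|(z : ℝ)| • ![σ z, τ z]) y < ε := by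
  have h3 := finrank_eq_three hindep hspan
  obtain ⟨e, d, a, c, he1, hd1, hNe, hNd, hae, hbe, had, hbd, hac, hΛ⟩ :=
    exists_pos_units_of_totallyReal hindep hspan h1 h2 h12 hN
  have hσ0 : ∀ (ρ : K →+* ℝ) {x : K}, x ≠ 0 → ρ x ≠ 0 := fun ρ x hx =>
    (map_ne_zero ρ).2 hx
  have hs0' : (s : ℝ) ≠ 0 := by exact_mod_cast hs0
  have hy0 : y 0 ≠ 0 := left_ne_zero_of_mul (b := y 1) (by
    rw [hy]
    exact mul_ne_zero (abs_ne_zero.2 hs0') (mul_ne_zero (hσ0 σ hs0) (hσ0 τ hs0)))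
  -- Replacing `s` by `-s` switches to the branch containing `y`.
  wlog hsgn : 0 < y 0 / σ s generalizing s
  · refine this (s := -s) (neg_mem hs) (neg_ne_zero.2 hs0) ?_ ?_ ?_
    · simpa using hy
    · simpa using hs0'
    · have : y 0 / σ s ≠ 0 := div_ne_zero hy0 (hσ0 σ hs0)
      have := lt_of_le_of_ne (not_lt.1 hsgn) this
      simpa [div_neg] using this
  -- A rational, necessarily negative, ratio gives natural exponents for which `e ^ r.den * d ^ k`
  -- exceeds 1, has norm 1 and equal conjugates under `σ` and `τ`.
  have hirr : Irrational (a / c) := by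
    have hc : c ≠ 0 := by rintro rfl; simp at hac
    rintro ⟨r, hr⟩
    have hrneg : r < 0 := by
      have : a / c < 0 := by
        rcases mul_neg_iff.1 hac with ⟨h, h'⟩ | ⟨h, h'⟩
        · exact div_neg_of_pos_of_neg h h'
        · exact div_neg_of_neg_of_pos h h'
      rw [← hr] at this
      exact_mod_cast this
    have hnum : r.num < 0 := Rat.num_neg.2 hrneg
    obtain ⟨k, hk⟩ := Int.eq_ofNat_of_zero_le (neg_nonneg.2 hnum.le)
    have hrel : (r.den : ℝ) * a + k * c = 0 := by
      have hk' : (k : ℝ) = -(r.num : ℝ) := by exact_mod_cast hk.symm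
      have hden : (r.den : ℝ) ≠ 0 := by exact_mod_cast r.den_nz
      rw [Rat.cast_def, div_eq_div_iff hden hc] at hr
      rw [hk']
      linarith
    set x := e ^ r.den * d ^ k with hx
    have hx1 : (1 : ℝ) < x := by
      have := one_lt_mul_of_lt_of_le (one_lt_pow₀ he1 r.den_nz) (one_le_pow₀ (n := k) hd1.le)
      simpa [hx] using this
    have hNx : Algebra.norm ℚ x = 1 := by rw [hx, map_mul, map_pow, map_pow, hNe, hNd]; simp
    refine embeddings_ne_of_one_lt_of_norm_eq_one h3 h12 hx1 hNx ?_
    have hsx : √(x : ℝ) ≠ 0 := (Real.sqrt_pos.2 (by linarith)).ne'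
    have hsplit : ∀ ρ : K →+* ℝ, √(x : ℝ) * ρ x =
        (√(e : ℝ) * ρ e) ^ r.den * (√(d : ℝ) * ρ d) ^ k := fun ρ => by
      rw [← sqrt_mul_map_pow _ he1, ← sqrt_mul_map_pow _ hd1, hx, map_mul]
      have : √((e ^ r.den * d ^ k : K) : ℝ) = √((e ^ r.den : K) : ℝ) * √((d ^ k : K) : ℝ) := by
        rw [← Real.sqrt_mul (by simp; positivity)]
        simp
      rw [this]
      ring
    refine mul_left_cancel₀ hsx ?_
    rw [hsplit, hsplit, hae, hbe, had, hbd, ← Real.exp_nat_mul, ← Real.exp_nat_mul,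
      ← Real.exp_nat_mul, ← Real.exp_nat_mul, ← Real.exp_add, ← Real.exp_add]
    congr 1
    linarith
  -- `t` is the hyperbolic angle from the scaled conjugates of `s` to `y`; the factor `e ^ m * d ^
  -- n` adds the angle `m a + n c`.
  set t := Real.log (y 0 / (√|(s : ℝ)| * σ s)) with ht
  have hsq : 0 < √|(s : ℝ)| := Real.sqrt_pos.2 (abs_pos.2 hs0')
  have hyt : y = ![√|(s : ℝ)| * σ s * Real.exp t, √|(s : ℝ)| * τ s * Real.exp (-t)] := by
    have hpos : 0 < y 0 / (√|(s : ℝ)| * σ s) := by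
      rw [mul_comm, ← div_div]
      exact div_pos hsgn hsq
    have hne : √|(s : ℝ)| * σ s ≠ 0 := mul_ne_zero hsq.ne' (hσ0 σ hs0)
    have e0 : y 0 = √|(s : ℝ)| * σ s * Real.exp t := by
      rw [ht, Real.exp_log hpos, mul_div_cancel₀ _ hne]
    have e1 : y 1 = √|(s : ℝ)| * τ s * Real.exp (-t) := by
      refine mul_left_cancel₀ hy0 ?_
      rw [hy, Real.exp_neg, e0]
      have := Real.mul_self_sqrt (abs_nonneg (s : ℝ))
      have := Real.exp_ne_zero t
      field_simp
      linear_combination (-σ s * τ s) * Real.mul_self_sqrt (abs_nonneg (s : ℝ))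
    ext i
    fin_cases i
    · exact e0
    · exact e1
  have hcont : Continuous fun v : ℝ =>
      ![√|(s : ℝ)| * σ s * Real.exp v, √|(s : ℝ)| * τ s * Real.exp (-v)] := by
    refine continuous_pi fun i => ?_
    fin_cases i
    · simp; fun_prop
    · simp; fun_prop
  obtain ⟨δ, hδ, hδ'⟩ := Metric.continuous_iff.1 hcont t ε hε
  obtain ⟨M, hM⟩ := pow_unbounded_of_one_lt ((B : ℝ) / |(s : ℝ)|) he1
  obtain ⟨m, n, hm, hmn⟩ := exists_nat_mul_add_nat_mul_near hirr hac t hδ M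
  have hem : (0 : ℝ) < (e : ℝ) ^ m := by positivity
  have hdn : (0 : ℝ) < (d : ℝ) ^ n := by positivity
  refine ⟨e ^ m * (d ^ n * s), pow_mul_mem (fun x hx => (hΛ x hx).1)
    (pow_mul_mem (fun x hx => (hΛ x hx).2) hs n) m, ?_, ?_⟩
  · have : |((e ^ m * (d ^ n * s) : K) : ℝ)| = (e : ℝ) ^ m * ((d : ℝ) ^ n * |(s : ℝ)|) := by
      simp [abs_mul, abs_of_pos hem, abs_of_pos hdn]
    rw [div_lt_iff₀ (abs_pos.2 hs0')] at hM
    calc (B : ℝ) < (e : ℝ) ^ M * |(s : ℝ)| := hM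
      _ ≤ (e : ℝ) ^ m * |(s : ℝ)| := by gcongr; exact he1.le
      _ ≤ (e : ℝ) ^ m * ((d : ℝ) ^ n * |(s : ℝ)|) := by
        gcongr
        exact le_mul_of_one_le_left (abs_nonneg _) (one_le_pow₀ hd1.le)
      _ = _ := this.symm
  · have hsplit : ∀ ρ : K →+* ℝ, √|((e ^ m * (d ^ n * s) : K) : ℝ)| * ρ (e ^ m * (d ^ n * s)) =
        (√|(s : ℝ)| * ρ s) * ((√(e : ℝ) * ρ e) ^ m * (√(d : ℝ) * ρ d) ^ n) := fun ρ => by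
      have : |((e ^ m * (d ^ n * s) : K) : ℝ)| = (e : ℝ) ^ m * ((d : ℝ) ^ n * |(s : ℝ)|) := by
        simp [abs_mul, abs_of_pos hem, abs_of_pos hdn]
      rw [this, Real.sqrt_mul hem.le, Real.sqrt_mul hdn.le, ← sqrt_mul_map_pow _ he1,
        ← sqrt_mul_map_pow _ hd1, map_mul, map_mul]
      push_cast
      ring
    have hlt := hδ' (m * a + n * c) (by rwa [Real.dist_eq])
    rw [← hyt] at hlt
    convert hlt using 2
    have hs' : √|((e ^ m * (d ^ n * s) : K) : ℝ)| •
        ![σ (e ^ m * (d ^ n * s)), τ (e ^ m * (d ^ n * s))] =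
        ![√|((e ^ m * (d ^ n * s) : K) : ℝ)| * σ (e ^ m * (d ^ n * s)),
          √|((e ^ m * (d ^ n * s) : K) : ℝ)| * τ (e ^ m * (d ^ n * s))] := by simp
    rw [hs', hsplit, hsplit, hae, hbe, had, hbd, ← Real.exp_nat_mul, ← Real.exp_nat_mul,
      ← Real.exp_nat_mul, ← Real.exp_nat_mul, ← Real.exp_add, ← Real.exp_add]
    congr 3
    congr 2
    ring

end RealApproximation

/-! ### Complex case: density along circles -/

section ComplexApproximation

variable {K : IntermediateField ℚ ℝ} {α : Fin 2 → K}

theorem isReal_algebraMap : ComplexEmbedding.IsReal (algebraMap K ℂ) := by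
  rw [ComplexEmbedding.isReal_iff]
  ext x
  exact Complex.conj_ofReal x

/-- Norm 1 puts `√e φ e` on the unit circle. Were it a root of unity, some `φ (e ^ n)` would be
real, so `φ` and its conjugate would agree at an element above 1 of norm 1. -/
theorem exists_pos_unit_of_complex [NumberField K]
    (hindep : LinearIndependent ℚ ![(1 : K), α 0, α 1])
    (hspan : Submodule.span ℚ (Set.range ![(1 : K), α 0, α 1]) = ⊤) {φ : K →+* ℂ}
    (hφ : ¬ ComplexEmbedding.IsReal φ)
    (hN : ∀ s : K, (Algebra.norm ℚ s : ℝ) = s * ‖φ s‖ ^ 2) :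
    ∃ (e : K) (a : ℝ), (1 : ℝ) < e ∧ (√e : ℝ) * φ e = Complex.exp (a * Complex.I) ∧
      Irrational (a / (2 * Real.pi)) ∧
      ∀ s ∈ traceDual K (Submodule.span ℤ (Set.range ![(1 : K), α 0, α 1])),
        e * s ∈ traceDual K (Submodule.span ℤ (Set.range ![(1 : K), α 0, α 1])) := by
  have h3 := finrank_eq_three hindep hspan
  obtain ⟨e, _, -, hNe, -, hpos, hlt, hΛ⟩ :=
    exists_pos_unit_dominant hindep hspan (InfinitePlace.mk (algebraMap K ℂ))
  have hφe : ‖φ e‖ < 1 := by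
    rw [← InfinitePlace.apply]
    refine hlt _ fun heq => hφ ?_
    rcases InfinitePlace.mk_eq_iff.1 heq with h | h
    · rw [h]; exact isReal_algebraMap
    · rw [← ComplexEmbedding.isReal_conjugate_iff, h]; exact isReal_algebraMap
  have he0 : (0 : ℝ) < e := (hpos (algebraMap K ℝ)).1
  have hNe' : (e : ℝ) * ‖φ e‖ ^ 2 = 1 := by rw [← hN, hNe]; simp
  have he1 : (1 : ℝ) < e := by
    by_contra! hle
    have h2 : ‖φ e‖ ^ 2 < 1 := pow_lt_one₀ (norm_nonneg _) hφe two_ne_zero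
    exact absurd hNe' (mul_lt_one_of_nonneg_of_lt_one_right hle (by positivity) h2).ne
  set w : ℂ := (√e : ℝ) * φ e with hw
  have hwn : ‖w‖ = 1 := by
    rw [hw, norm_mul, Complex.norm_real, Real.norm_eq_abs, abs_of_nonneg (Real.sqrt_nonneg _),
      ← pow_eq_one_iff_of_nonneg (by positivity) two_ne_zero, mul_pow, Real.sq_sqrt he0.le, hNe']
  have hwexp : w = Complex.exp (w.arg * Complex.I) := by
    have := Complex.norm_mul_exp_arg_mul_I w
    rw [hwn] at this
    simpa using this.symm
  refine ⟨e, w.arg, he1, hwexp, ?_, fun s hs => (hΛ s hs).1⟩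
  rintro ⟨r, hr⟩
  have hden : (r.den : ℝ) ≠ 0 := by exact_mod_cast r.den_nz
  have hrel : (r.den : ℝ) * w.arg = r.num * (2 * Real.pi) := by
    rw [Rat.cast_def, div_eq_div_iff hden (by positivity)] at hr
    linarith
  have hpow : w ^ r.den = 1 := by
    rw [hwexp, ← Complex.exp_nat_mul, Complex.exp_eq_one_iff]
    refine ⟨r.num, ?_⟩
    have := congrArg (fun x : ℝ => (x : ℂ)) hrel
    push_cast at this
    linear_combination Complex.I * this
  have hx1 : (1 : ℝ) < (e ^ r.den : K) := by
    simpa using one_lt_pow₀ he1 r.den_nz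
  refine embeddings_ne_of_one_lt_of_norm_eq_one h3
    (φ := ComplexEmbedding.conjugate φ) (ψ := φ) (fun h => hφ (ComplexEmbedding.isReal_iff.2 h))
    hx1 (by rw [map_pow, hNe, one_pow]) ?_
  have hs : (((√e : ℝ) ^ r.den : ℝ) : ℂ) ≠ 0 := by
    have := Real.sqrt_pos.2 he0
    exact_mod_cast (pow_pos this _).ne'
  have h1 : (((√e : ℝ) ^ r.den : ℝ) : ℂ) * φ (e ^ r.den) = 1 := by
    rw [← hpow, hw, mul_pow, map_pow]
    push_cast
    rfl
  refine mul_left_cancel₀ hs ?_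
  rw [h1, ComplexEmbedding.conjugate_coe_eq]
  have := congrArg (starRingEnd ℂ) h1
  rwa [map_mul, Complex.conj_ofReal, map_one] at this

theorem exists_near_circle_point [NumberField K]
    (hindep : LinearIndependent ℚ ![(1 : K), α 0, α 1])
    (hspan : Submodule.span ℚ (Set.range ![(1 : K), α 0, α 1]) = ⊤) {φ : K →+* ℂ}
    (hφ : ¬ ComplexEmbedding.IsReal φ)
    (hN : ∀ s : K, (Algebra.norm ℚ s : ℝ) = s * ‖φ s‖ ^ 2)
    {s : K} (hs : s ∈ traceDual K (Submodule.span ℤ (Set.range ![(1 : K), α 0, α 1])))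
    (hs0 : s ≠ 0) {y : Fin 2 → ℝ} (hy : y 0 ^ 2 + y 1 ^ 2 = |(s : ℝ)| * ‖φ s‖ ^ 2)
    (B : ℕ) {ε : ℝ} (hε : 0 < ε) :
    ∃ z ∈ traceDual K (Submodule.span ℤ (Set.range ![(1 : K), α 0, α 1])),
      (B : ℝ) < |(z : ℝ)| ∧ dist (√|(z : ℝ)| • ![(φ z).re, (φ z).im]) y < ε := by
  obtain ⟨e, a, he1, hexp, hirr, hΛ⟩ := exists_pos_unit_of_complex hindep hspan hφ hN
  have hs0' : (s : ℝ) ≠ 0 := by exact_mod_cast hs0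
  set c : ℂ := (√|(s : ℝ)| : ℝ) * φ s with hc
  have hc0 : c ≠ 0 := by
    refine mul_ne_zero ?_ ((map_ne_zero φ).2 hs0)
    exact_mod_cast (Real.sqrt_pos.2 (abs_pos.2 hs0')).ne'
  set z : ℂ := ⟨y 0, y 1⟩ with hz
  have hzc : ‖z / c‖ = 1 := by
    rw [norm_div, div_eq_one_iff_eq (norm_ne_zero_iff.2 hc0),
      ← sq_eq_sq₀ (norm_nonneg _) (norm_nonneg _), hc, norm_mul, mul_pow, Complex.norm_real,
      Real.norm_eq_abs, sq_abs, Real.sq_sqrt (abs_nonneg _), ← hy, Complex.sq_norm,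
      Complex.normSq_apply, hz]
    ring
  set t := (z / c).arg with ht
  have hzt : z = c * Complex.exp (t * Complex.I) := by
    have := Complex.norm_mul_exp_arg_mul_I (z / c)
    rw [hzc, Complex.ofReal_one, one_mul] at this
    rw [ht, this, mul_div_cancel₀ _ hc0]
  have hcont : Continuous fun v : ℝ =>
      ![(c * Complex.exp (v * Complex.I)).re, (c * Complex.exp (v * Complex.I)).im] := by
    have h0 : Continuous fun v : ℝ => c * Complex.exp (v * Complex.I) := by fun_prop
    refine continuous_pi fun i => ?_
    fin_cases i
    · exact Complex.continuous_re.comp h0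
    · exact Complex.continuous_im.comp h0
  have hyt : y = ![(c * Complex.exp (t * Complex.I)).re, (c * Complex.exp (t * Complex.I)).im] := by
    rw [← hzt]
    ext i
    fin_cases i <;> rfl
  obtain ⟨δ, hδ, hδ'⟩ := Metric.continuous_iff.1 hcont t ε hε
  obtain ⟨M, hM⟩ := pow_unbounded_of_one_lt ((B : ℝ) / |(s : ℝ)|) he1
  obtain ⟨m, hm, n, hmn⟩ := exists_nat_mul_add_int_mul_near hirr (by positivity) t hδ M
  have hem : (0 : ℝ) < (e : ℝ) ^ m := by positivity
  have habs : |((e ^ m * s : K) : ℝ)| = (e : ℝ) ^ m * |(s : ℝ)| := by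
    simp [abs_mul, abs_of_pos hem]
  refine ⟨e ^ m * s, pow_mul_mem hΛ hs m, ?_, ?_⟩
  · rw [div_lt_iff₀ (abs_pos.2 hs0')] at hM
    calc (B : ℝ) < (e : ℝ) ^ M * |(s : ℝ)| := hM
      _ ≤ (e : ℝ) ^ m * |(s : ℝ)| := by gcongr; exact he1.le
      _ = _ := habs.symm
  · have hlt := hδ' (m * a + n * (2 * Real.pi)) (by rwa [Real.dist_eq])
    rw [← hyt] at hlt
    convert hlt using 2
    have hper : Complex.exp (((m * a + n * (2 * Real.pi) : ℝ) : ℂ) * Complex.I) =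
        Complex.exp (a * Complex.I) ^ m := by
      rw [← Complex.exp_nat_mul]
      have : (((m * a + n * (2 * Real.pi) : ℝ) : ℂ) * Complex.I) =
          m * (a * Complex.I) + n * (2 * Real.pi * Complex.I) := by push_cast; ring
      rw [this, Complex.exp_add, Complex.exp_int_mul_two_pi_mul_I, mul_one]
    have hsplit : ((√|((e ^ m * s : K) : ℝ)| : ℝ) : ℂ) * φ (e ^ m * s) =
        c * Complex.exp (a * Complex.I) ^ m := by
      rw [habs, Real.sqrt_mul hem.le, ← hexp, hc, mul_pow, map_mul, map_pow]
      rw [sqrt_pow_eq (by linarith)]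
      push_cast
      ring
    rw [hper, ← hsplit, Complex.re_ofReal_mul, Complex.im_ofReal_mul]
    simp

end ComplexApproximation

/-! ### From level curves to the union formula -/

namespace ConjugateModel

variable {K : IntermediateField ℚ ℝ} {α : Fin 2 → K} (M : ConjugateModel K α)

theorem mem_smul_image_iff {ν κ : ℝ} (hν : 0 < ν) {x : Fin 2 → ℝ} :
    x ∈ ν ^ (1 / 2 : ℝ) • (M.error '' {y | M.form y = κ}) ↔
      M.form (M.error.symm x) = ν * κ := by
  rw [← Real.sqrt_eq_rpow]
  have hs := (Real.sqrt_pos.2 hν).ne'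
  constructor
  · rintro ⟨_, ⟨y, hy, rfl⟩, rfl⟩
    simp only [map_smul, LinearEquiv.symm_apply_apply]
    rw [M.form_sqrt_smul hν.le, hy]
  · intro h
    refine (Set.mem_smul_set_iff_inv_smul_mem₀ hs _ _).2
      ⟨(√ν)⁻¹ • M.error.symm x, ?_, by simp⟩
    show M.form _ = κ
    rw [M.form_smul, h, inv_pow, Real.sq_sqrt hν.le, inv_mul_cancel_left₀ hν.ne']

/-- `κ s` is the sign of the form at `conj s`, which lets one statement serve the definite and the
indefinite form: homogeneity rescales level `|N(s)| κ s` to level `κ s`. -/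
theorem accumulationSet_eq_of_subset [FiniteDimensional ℚ K]
    (hindep : LinearIndependent ℚ ![(1 : K), α 0, α 1])
    (hspan : Submodule.span ℚ (Set.range ![(1 : K), α 0, α 1]) = ⊤)
    (hform : ∀ s ≠ 0, M.form (M.conj s) ≠ 0)
    (κ : K → ℝ) (hκ : ∀ s, M.form (M.conj s) = κ s * |M.form (M.conj s)|)
    (h : ∀ s ∈ traceDual K (Submodule.span ℤ (Set.range ![(1 : K), α 0, α 1])), s ≠ 0 →
      ∀ y, M.form y = |(s : ℝ)| * M.form (M.conj s) →
        M.error y ∈ accumulationSet (1 / 2) (fun i => (α i : ℝ))) :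
    accumulationSet (1 / 2) (fun i => (α i : ℝ)) =
      ⋃ s ∈ {s : K | s ∈ traceDual K (Submodule.span ℤ (Set.range ![(1 : K), α 0, α 1])) ∧ s ≠ 0},
        (|(Algebra.norm ℚ s : ℝ)| ^ (1 / 2 : ℝ)) • (M.error '' {y | M.form y = κ s}) := by
  have hν : ∀ s : K, s ≠ 0 → 0 < |(Algebra.norm ℚ s : ℝ)| := fun s hs => by
    rw [M.norm_abs_eq]
    have : (s : ℝ) ≠ 0 := by exact_mod_cast hs
    exact mul_pos (abs_pos.2 this) (abs_pos.2 (hform s hs))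
  have heq : ∀ s : K, |(s : ℝ)| * M.form (M.conj s) = |(Algebra.norm ℚ s : ℝ)| * κ s :=
    fun s => by
      rw [M.norm_abs_eq, mul_assoc, mul_comm _ (κ s), ← hκ]
  ext x
  simp only [Set.mem_iUnion, Set.mem_ofPred_eq, exists_prop]
  constructor
  · intro hx
    obtain ⟨s, hs, hs0, hx⟩ := M.exists_form_eq_of_mem_accumulationSet hindep hspan hx
    exact ⟨s, ⟨hs, hs0⟩, (M.mem_smul_image_iff (hν s hs0)).2 (by rw [hx, heq])⟩
  · rintro ⟨s, ⟨hs, hs0⟩, hx⟩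
    rw [M.mem_smul_image_iff (hν s hs0), ← heq] at hx
    simpa using h s hs hs0 _ hx

end ConjugateModel

/-! ### The two cases of the theorem -/

section Main

variable {K : IntermediateField ℚ ℝ} {α : Fin 2 → K}

theorem accumulationSet_eq_of_complex [NumberField K]
    (hindep : LinearIndependent ℚ ![(1 : K), α 0, α 1])
    (hspan : Submodule.span ℚ (Set.range ![(1 : K), α 0, α 1]) = ⊤) {φ : K →+* ℂ}
    (hφ : ¬ ComplexEmbedding.IsReal φ) :
    ∃ C : Set (Fin 2 → ℝ), IsEllipse C ∧
      accumulationSet (1 / 2) (fun i => (α i : ℝ)) =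
        ⋃ s ∈ {s : K | s ∈ traceDual K (Submodule.span ℤ (Set.range ![(1 : K), α 0, α 1])) ∧
            s ≠ 0},
          (|(Algebra.norm ℚ s : ℝ)| ^ (1 / 2 : ℝ)) • C := by
  have h3 := finrank_eq_three hindep hspan
  have h1 : algebraMap K ℂ ≠ φ := fun h => hφ (h ▸ isReal_algebraMap)
  have h2 : algebraMap K ℂ ≠ ComplexEmbedding.conjugate φ := fun h =>
    hφ (ComplexEmbedding.isReal_conjugate_iff.1 (h ▸ isReal_algebraMap))
  have h12 : φ ≠ ComplexEmbedding.conjugate φ := fun h =>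
    hφ (ComplexEmbedding.isReal_iff.2 h.symm)
  have hTN : ∀ s : K, (Algebra.trace ℚ K s : ℝ) = s + 2 * (φ s).re ∧
      (Algebra.norm ℚ s : ℝ) = s * ((φ s).re ^ 2 + (φ s).im ^ 2) := fun s => by
    obtain ⟨ht, hn⟩ := norm_trace_of_three_embeddings h3 h1 h2 h12 s
    rw [ComplexEmbedding.conjugate_coe_eq] at ht hn
    constructor
    · have := congrArg Complex.re ht
      simp at this
      linarith
    · rw [mul_assoc, Complex.mul_conj, Complex.normSq_apply] at hn
      have : (Algebra.norm ℚ s : ℝ) = s * ((φ s).re * (φ s).re + (φ s).im * (φ s).im) := by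
        exact_mod_cast hn
      rw [this]; ring
  have hinj : ∀ u v : ℝ, (∀ i, u * (2 * (α i - (φ (α i)).re)) + v * (2 * (φ (α i)).im) = 0) →
      u = 0 ∧ v = 0 := fun u v h => by
    -- With coefficients `u + iv` and `u - iv` the complex relation is twice the real part of `(u +
    -- iv)(αᵢ - φ αᵢ)`, which is the real relation.
    have key := (eq_zero_of_combination_eq_zero hspan h1 h2 h12
      (u := ⟨u, v⟩) (v := ⟨u, -v⟩) fun i => by
        have := h i
        apply Complex.ext
        · simp [ComplexEmbedding.conjugate_coe_eq]
          linarith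
        · simp [ComplexEmbedding.conjugate_coe_eq]
          ring).1
    exact ⟨congrArg Complex.re key, congrArg Complex.im key⟩
  have hsq : ∀ s : K, (φ s).re ^ 2 + (φ s).im ^ 2 = ‖φ s‖ ^ 2 := fun s => by
    rw [Complex.sq_norm, Complex.normSq_apply]; ring
  let M := complexModel φ hTN hinj
  refine ⟨M.error '' {y | y 0 ^ 2 + y 1 ^ 2 = 1}, ⟨M.error.toAffineEquiv, rfl⟩, ?_⟩
  have hfc : ∀ s : K, M.form (M.conj s) = ‖φ s‖ ^ 2 := fun s => hsq s
  refine M.accumulationSet_eq_of_subset hindep hspan (fun s hs => ?_) (fun _ => 1) (fun s => ?_)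
    fun s hs hs0 y hy => ?_
  · rw [hfc]
    exact pow_ne_zero _ (norm_ne_zero_iff.2 ((map_ne_zero φ).2 hs))
  · rw [hfc, one_mul, abs_of_nonneg (by positivity)]
  · rw [hfc] at hy
    have hy' : y 0 ^ 2 + y 1 ^ 2 = |(s : ℝ)| * ‖φ s‖ ^ 2 := hy
    -- Rotating `y` stays on its level circle; the half turn reaches `-y ≠ y`, so the curve is
    -- nontrivial.
    let γ : ℝ → Fin 2 → ℝ := fun t =>
      ![y 0 * Real.cos t - y 1 * Real.sin t, y 0 * Real.sin t + y 1 * Real.cos t]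
    have hγ : Continuous γ := by
      refine continuous_pi fun i => ?_
      fin_cases i
      · simp [γ]; fun_prop
      · simp [γ]; fun_prop
    have hγ0 : γ 0 = y := by
      ext i
      fin_cases i <;> simp [γ]
    rw [← hγ0]
    refine M.error_mem_accumulationSet hγ (a := 0) (b := Real.pi) (fun heq => ?_) (fun t => ?_) 0
    · have e0 := congrFun heq 0
      have e1 := congrFun heq 1
      simp [γ] at e0 e1
      have e0' : y 0 = 0 := by linarith
      have e1' : y 1 = 0 := by linarith
      rw [e0', e1'] at hy'
      have : |(s : ℝ)| * ‖φ s‖ ^ 2 ≠ 0 :=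
        mul_ne_zero (abs_ne_zero.2 (by exact_mod_cast hs0))
          (pow_ne_zero _ (norm_ne_zero_iff.2 ((map_ne_zero φ).2 hs0)))
      exact this (by rw [← hy']; norm_num)
    · refine M.error_mem_closure fun B τ hτ => ?_
      refine exists_near_circle_point hindep hspan hφ (fun s => ?_) hs hs0 ?_ B hτ
      · rw [(hTN s).2, hsq]
      · rw [← hy']
        simp only [γ, Matrix.cons_val_zero, Matrix.cons_val_one]
        linear_combination (y 0 ^ 2 + y 1 ^ 2) * Real.sin_sq_add_cos_sq t

theorem exists_real_embeddings [NumberField K] [IsTotallyReal K]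
    (h3 : Module.finrank ℚ K = 3) :
    ∃ σ τ : K →+* ℝ, algebraMap K ℝ ≠ σ ∧ algebraMap K ℝ ≠ τ ∧ σ ≠ τ ∧
      algebraMap K ℂ ≠ Complex.ofRealHom.comp σ ∧ algebraMap K ℂ ≠ Complex.ofRealHom.comp τ ∧
      Complex.ofRealHom.comp σ ≠ Complex.ofRealHom.comp τ := by
  classical
  have hcard : ((Finset.univ : Finset (K →+* ℂ)).erase (algebraMap K ℂ)).card = 2 := by
    rw [Finset.card_erase_of_mem (Finset.mem_univ _), Finset.card_univ, Embeddings.card, h3]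
  obtain ⟨φ, ψ, hne, heq⟩ := Finset.card_eq_two.1 hcard
  have hφ : φ ≠ algebraMap K ℂ := Finset.ne_of_mem_erase (heq ▸ Finset.mem_insert_self φ {ψ})
  have hψ : ψ ≠ algebraMap K ℂ := Finset.ne_of_mem_erase (s := Finset.univ) (heq ▸ by simp)
  have hex : ∀ χ : K →+* ℂ, ∃ ρ : K →+* ℝ, Complex.ofRealHom.comp ρ = χ := fun χ =>
    ⟨(IsTotallyReal.complexEmbedding_isReal χ).embedding, RingHom.ext fun x =>
      ComplexEmbedding.IsReal.coe_embedding_apply _ x⟩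
  obtain ⟨σ, rfl⟩ := hex φ
  obtain ⟨τ, rfl⟩ := hex ψ
  exact ⟨σ, τ, fun h => hφ (h ▸ rfl), fun h => hψ (h ▸ rfl), fun h => hne (h ▸ rfl), hφ.symm,
    hψ.symm, hne⟩

theorem accumulationSet_eq_of_totallyReal [NumberField K] [IsTotallyReal K]
    (hindep : LinearIndependent ℚ ![(1 : K), α 0, α 1])
    (hspan : Submodule.span ℚ (Set.range ![(1 : K), α 0, α 1]) = ⊤) :
    ∃ C : Set (Fin 2 → ℝ), IsHyperbola C ∧
      ∃ ℓ : K → ((Fin 2 → ℝ) →ₗ[ℝ] (Fin 2 → ℝ)),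
        (∀ s, ℓ s = LinearMap.id ∨ AreConjugateHyperbolas C (ℓ s '' C)) ∧
        accumulationSet (1 / 2) (fun i => (α i : ℝ)) =
          ⋃ s ∈ {s : K | s ∈ traceDual K (Submodule.span ℤ (Set.range ![(1 : K), α 0, α 1])) ∧
              s ≠ 0},
            (|(Algebra.norm ℚ s : ℝ)| ^ (1 / 2 : ℝ)) • (ℓ s '' C) := by
  classical
  have h3 := finrank_eq_three hindep hspan
  obtain ⟨σ, τ, h1, h2, h12, h1', h2', h12'⟩ := exists_real_embeddings (K := K) h3
  have hTN : ∀ s : K, (Algebra.trace ℚ K s : ℝ) = s + σ s + τ s ∧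
      (Algebra.norm ℚ s : ℝ) = s * σ s * τ s := fun s => by
    obtain ⟨ht, hn⟩ := norm_trace_of_three_embeddings h3 h1' h2' h12' s
    simp only [RingHom.comp_apply, Complex.ofRealHom_eq_coe] at ht hn
    exact ⟨by exact_mod_cast ht, by exact_mod_cast hn⟩
  have hinj : ∀ u v : ℝ, (∀ i, u * (α i - σ (α i)) + v * (α i - τ (α i)) = 0) →
      u = 0 ∧ v = 0 := fun u v h => by
    have key := eq_zero_of_combination_eq_zero hspan h1' h2' h12' (u := u) (v := v) fun i => by
      simp only [RingHom.comp_apply, Complex.ofRealHom_eq_coe]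
      exact_mod_cast h i
    exact ⟨by exact_mod_cast key.1, by exact_mod_cast key.2⟩
  let M := realModel σ τ hTN hinj
  have hfc : ∀ s : K, M.form (M.conj s) = σ s * τ s := fun s => rfl
  let flip : (Fin 2 → ℝ) →ₗ[ℝ] (Fin 2 → ℝ) := Matrix.toLin' !![1, 0; 0, -1]
  have hflip : ∀ y, flip y = ![y 0, -y 1] := fun y => by
    ext i
    fin_cases i <;> simp [flip, Matrix.mulVec, dotProduct, Fin.sum_univ_two]
  -- When `σ s * τ s` is not positive, the reflection `y ↦ (y 0, -y 1)`, transported by `error`,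
  -- exchanges the levels 1 and -1.
  let ℓ : K → ((Fin 2 → ℝ) →ₗ[ℝ] (Fin 2 → ℝ)) := fun s =>
    if 0 < σ s * τ s then LinearMap.id else
      M.error.toLinearMap ∘ₗ flip ∘ₗ M.error.symm.toLinearMap
  let κ : K → ℝ := fun s => if 0 < σ s * τ s then 1 else -1
  have himage : ∀ s, ℓ s '' (M.error '' {y | y 0 * y 1 = 1}) =
      M.error '' {y | y 0 * y 1 = κ s} := fun s => by
    by_cases hs : 0 < σ s * τ s
    · simp [ℓ, κ, hs]
    · simp only [ℓ, κ, hs, if_false]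
      ext x
      constructor
      · rintro ⟨_, ⟨y, hy, rfl⟩, rfl⟩
        refine ⟨flip y, ?_, by simp⟩
        have hy : y 0 * y 1 = 1 := hy
        simp [hflip, hy]
      · rintro ⟨y, hy, rfl⟩
        refine ⟨M.error (flip y), ⟨flip y, ?_, rfl⟩, ?_⟩
        · have hy : y 0 * y 1 = -1 := hy
          simp [hflip, hy]
        · have : flip (flip y) = y := by
            rw [hflip, hflip]
            ext i
            fin_cases i <;> simp
          simp [this]
  refine ⟨M.error '' {y | y 0 * y 1 = 1}, ⟨M.error.toAffineEquiv, rfl⟩, ℓ, fun s => ?_, ?_⟩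
  · by_cases hs : 0 < σ s * τ s
    · left
      simp [ℓ, hs]
    · right
      refine ⟨M.error.toAffineEquiv, rfl, ?_⟩
      rw [himage]
      simp only [κ, hs, if_false]
      rfl
  simp only [himage]
  have hne : ∀ s : K, s ≠ 0 → σ s * τ s ≠ 0 := fun s hs =>
    mul_ne_zero ((map_ne_zero σ).2 hs) ((map_ne_zero τ).2 hs)
  refine M.accumulationSet_eq_of_subset hindep hspan hne κ (fun s => ?_) fun s hs hs0 y hy => ?_
  · rw [hfc]
    by_cases hs : 0 < σ s * τ s
    · simp only [κ, hs, if_true, abs_of_pos hs, one_mul]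
    · simp only [κ, hs, if_false, abs_of_nonpos (not_lt.1 hs)]
      ring
  · have hy' : y 0 * y 1 = |(s : ℝ)| * (σ s * τ s) := hy
    -- The hyperbolic flow sweeps out the branch through `y`, a connected subset of the level curve.
    let γ : ℝ → Fin 2 → ℝ := fun t => ![y 0 * Real.exp t, y 1 * Real.exp (-t)]
    have hγ : Continuous γ := by
      refine continuous_pi fun i => ?_
      fin_cases i
      · simp [γ]; fun_prop
      · simp [γ]; fun_prop
    have hγ0 : γ 0 = y := by
      ext i
      fin_cases i <;> simp [γ]
    rw [← hγ0]
    have hy0 : y 0 ≠ 0 := left_ne_zero_of_mul (b := y 1) (by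
      rw [hy']
      exact mul_ne_zero (abs_ne_zero.2 (by exact_mod_cast hs0)) (hne s hs0))
    refine M.error_mem_accumulationSet hγ (a := 0) (b := 1) (fun heq => ?_) (fun t => ?_) 0
    · have e0 := congrFun heq 0
      simp [γ, hy0] at e0
    · refine M.error_mem_closure fun B ε hε => ?_
      refine exists_near_hyperbola_point hindep hspan h1 h2 h12 (fun s => (hTN s).2) hs hs0 ?_ B hε
      rw [← hy']
      simp only [γ, Matrix.cons_val_zero, Matrix.cons_val_one]
      rw [mul_mul_mul_comm, ← Real.exp_add]
      simp

end Main

theorem theorem5 (K : IntermediateField ℚ ℝ) (α : Fin 2 → K)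
    (hindep : LinearIndependent ℚ ![(1 : K), α 0, α 1])
    (hspan : Submodule.span ℚ (Set.range ![(1 : K), α 0, α 1]) = ⊤)
    (Λdual : Submodule ℤ K)
    (hΛdual : Λdual = traceDual K (Submodule.span ℤ (Set.range ![(1 : K), α 0, α 1]))) :
    ((∃ φ : K →+* ℂ, ¬ NumberField.ComplexEmbedding.IsReal φ) →
      ∃ C : Set (Fin 2 → ℝ), IsEllipse C ∧
        accumulationSet (1 / 2) (fun i => (α i : ℝ)) =
          ⋃ s ∈ {s : K | s ∈ Λdual ∧ s ≠ 0},
            (|(Algebra.norm ℚ s : ℝ)| ^ (1 / 2 : ℝ)) • C) ∧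
    (NumberField.IsTotallyReal K →
      ∃ C : Set (Fin 2 → ℝ), IsHyperbola C ∧
        ∃ ℓ : K → ((Fin 2 → ℝ) →ₗ[ℝ] (Fin 2 → ℝ)),
          (∀ s ∈ Λdual, s ≠ 0 →
            ℓ s = LinearMap.id ∨ AreConjugateHyperbolas C (ℓ s '' C)) ∧
          accumulationSet (1 / 2) (fun i => (α i : ℝ)) =
            ⋃ s ∈ {s : K | s ∈ Λdual ∧ s ≠ 0},
              (|(Algebra.norm ℚ s : ℝ)| ^ (1 / 2 : ℝ)) • (ℓ s '' C)) := by
  subst hΛdual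
  have := finiteDimensional_of_span hspan
  have : NumberField K := ⟨⟩
  refine ⟨fun ⟨φ, hφ⟩ => accumulationSet_eq_of_complex hindep hspan hφ, fun _ => ?_⟩
  obtain ⟨C, hC, ℓ, hℓ, h⟩ := accumulationSet_eq_of_totallyReal hindep hspan
  exact ⟨C, hC, ℓ, fun s _ _ => hℓ s, h⟩
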